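/- For $\alpha\in(0,1)$ let $R_\alpha(x)=x+\alpha \pmod 1$ on $[0,1)$, and let $f(x)=\frac1x$ for $x\in(0,1)$, with the convention $f(0)=0$. For $N\ge 1$ define the lightly trimmed sum $$S_N^1(f)(x)=\sum_{n=0}^{N-1} f(R_\alpha^n x)-\max_{0\le n\le N-1} f(R_\alpha^n x).$$ (i) For Lebesgue-almost every $\alpha\in(0,1)$ it holds that $$\lim_{N\to\infty}\frac{S_N^1(f)(x)}{N\log N}=1\qquad\text{for Lebesgue-a.e. } x\in[0,1).$$ (ii) If $\alpha\in(0,1)$ is irrational and of bounded type, i.e. the coefficients $a_1,a_2,\dots$ of its continued fraction expansion $\alpha=[a_1,a_2,\dots]$ are bounded, then $$\lim_{N\to\infty}\frac{S_N^1(f)(x)}{N\log N}=1\qquad\text{uniformly in } x\in[0,1).$$ -/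

import Mathlib

open Filter Set MeasureTheory
open scoped Topology

namespace LightTrimming

/-- The rotation `R_α(x) = x + α (mod 1)`, with the circle identified with `[0, 1)`. -/
noncomputable def rotation (α x : ℝ) : ℝ := Int.fract (x + α)

/-- The function `1 / x` on `[0, 1)`, with the convention that its value at the pole `0` is `0`. -/
noncomputable def recip (x : ℝ) : ℝ := if x = 0 then 0 else 1 / x

/-- The trimmed sum `S_N^k(f)(x)` of `f` along the orbit of `x` under `T`: the Birkhoff sum over the
times `0, …, N - 1`, minus the largest value of the sum of `f` over `k` distinct times among them
(the finsets of `k` such times are the choices `n₁ < … < n_k`). It is `0` when `k > N`. -/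
noncomputable def trimmedSum {X : Type*} (T : X → X) (f : X → ℝ) (k N : ℕ) (x : X) : ℝ :=
  if h : k ≤ N then
    birkhoffSum T f N x -
      ((Finset.range N).powersetCard k).sup'
        (Finset.powersetCard_nonempty.2 (by simpa using h))
        (fun s => ∑ n ∈ s, f (T^[n] x))
  else 0

/-- An irrational number is of bounded type if the coefficients `a₁, a₂, …` of its continued
fraction expansion are bounded. -/
def BoundedType (α : ℝ) : Prop :=
  Irrational α ∧
    ∃ M : ℝ, ∀ (n : ℕ) (a : ℝ), (GenContFract.of α).partDens.get? n = some a → a ≤ M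

end LightTrimming

/-! Replace `1/y` by its truncation `1 / max y δ`, whose integral over the unit interval is `1 + log
(1/δ)`. For `δ` near `1/N` up to logarithmic factors, `N` times this integral is asymptotic to `N
log N`. It remains to control the fluctuation of the truncated Birkhoff sum and the effect of the
orbit points in `[0, δ)`, of which trimming removes one.

Bounded type: take `δ = log N / N`. Bounded coefficients make `α` badly approximable
(`BoundedType.exists_le_abs_sub_rat`). Denjoy-Koksma on blocks of good denominators then gives a
fluctuation `O(log N / δ) = O(N)` (`abs_sum_sub_integral_le`). The first `N` orbit points are
`c/N`-separated, so `[0, δ)` holds `O(log N)` of them, and without the nearest one their reciprocals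
sum to `O(N log log N)` by comparison with a harmonic sum (`sum_one_div_fract_le`). All bounds are
uniform in `x`.

Almost every `α`: for `(α, x)` uniform, the points `x + nα` are pairwise independent. Chebyshev
bounds the fluctuation, and a union bound shows that two visits to `[0, δ)` are unlikely. Along `N_k
≈ exp (k^(9/10))` both probabilities are summable (`measure_exceptionalSet_le`), so Borel-Cantelli
applies. Trimmed sums of a nonnegative function increase with `N`, and `N log N` changes by a factor
tending to `1` between control times, which fills the gaps (`tendsto_div_of_monotone_of_subseq`). -/

namespace LightTrimming

/-! ### Bounded type implies badly approximable. -/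

section ContinuedFractions

open GenContFract

theorem exists_int_contsAux_eq (α : ℝ) (n : ℕ) :
    ∃ A B : ℤ, (GenContFract.of α).contsAux n = ⟨(A : ℝ), (B : ℝ)⟩ := by
  induction n using Nat.twoStepInduction with
  | zero => exact ⟨1, 0, by simp [contsAux]⟩
  | one => exact ⟨⌊α⌋, 1, by simp [contsAux]⟩
  | more n h1 h2 =>
    obtain ⟨A1, B1, h1⟩ := h1
    obtain ⟨A2, B2, h2⟩ := h2
    rcases hs : (GenContFract.of α).s.get? n with _ | gp
    · refine ⟨A2, B2, ?_⟩
      rw [← h2]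
      exact contsAux_stable_step_of_terminated hs
    · obtain ⟨ha, z, hz⟩ := of_partNum_eq_one_and_exists_int_partDen_eq hs
      refine ⟨z * A2 + A1, z * B2 + B1, ?_⟩
      rw [contsAux_recurrence hs h1 h2, ha, hz]
      push_cast
      simp

theorem not_terminatedAt_of_irrational {α : ℝ} (hα : Irrational α) (n : ℕ) :
    ¬ (GenContFract.of α).TerminatedAt n := fun h => by
  obtain ⟨q, hq⟩ := (terminates_iff_rat α).1 ⟨n, h⟩
  exact hα ⟨q, hq.symm⟩

/-- Multiplying the determinant identity `A B' - B A' = ±1` by the denominator of `q` and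
substituting `A = B q` exhibits that denominator as `B` times the absolute value of a nonzero
integer. -/
theorem dens_le_den_of_convs_eq {α : ℝ} (hα : Irrational α) {n : ℕ} {q : ℚ}
    (hq : (GenContFract.of α).convs n = q) : (GenContFract.of α).dens n ≤ q.den := by
  have hB : 0 < (GenContFract.of α).dens n :=
    lt_of_lt_of_le (by exact_mod_cast Nat.fib_pos.2 n.succ_pos)
      (succ_nth_fib_le_of_nth_den (Or.inr (not_terminatedAt_of_irrational hα _)))
  have hdet := (SimpContFract.of α).determinant (n := n) (not_terminatedAt_of_irrational hα n)
  change (GenContFract.of α).nums n * (GenContFract.of α).dens (n + 1) -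
    (GenContFract.of α).dens n * (GenContFract.of α).nums (n + 1) = (-1) ^ (n + 1) at hdet
  obtain ⟨A', B', h'⟩ := exists_int_contsAux_eq α (n + 2)
  have hA' : (GenContFract.of α).nums (n + 1) = A' := by
    rw [num_eq_conts_a, nth_cont_eq_succ_nth_contAux, h']
  have hB' : (GenContFract.of α).dens (n + 1) = B' := by
    rw [den_eq_conts_b, nth_cont_eq_succ_nth_contAux, h']
  rw [hA', hB'] at hdet
  set A := (GenContFract.of α).nums n
  set B := (GenContFract.of α).dens n
  have hA : A * q.den = B * q.num := by
    have h1 : A / B = q := hq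
    have h2 : (q : ℝ) * q.den = q.num := by exact_mod_cast Rat.mul_den_eq_num q
    rw [div_eq_iff hB.ne'] at h1
    rw [h1, ← h2]; ring
  have key : B * ((q.num * B' - q.den * A' : ℤ) : ℝ) = (-1) ^ (n + 1) * q.den := by
    push_cast
    rw [← hdet]
    linear_combination (-(B' : ℝ)) * hA
  have hd : (0 : ℝ) < q.den := by exact_mod_cast q.den_pos
  have habs : B * |((q.num * B' - q.den * A' : ℤ) : ℝ)| = q.den := by
    have := congrArg abs key
    rwa [abs_mul, abs_mul, abs_pow, abs_neg, abs_one, one_pow, one_mul, abs_of_pos hB,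
      abs_of_pos hd] at this
  have hne : (q.num * B' - q.den * A' : ℤ) ≠ 0 := fun h => by
    rw [h, Int.cast_zero, abs_zero, mul_zero] at habs
    exact hd.ne habs
  have h1 : (1 : ℝ) ≤ |((q.num * B' - q.den * A' : ℤ) : ℝ)| := by
    exact_mod_cast Int.one_le_abs hne
  nlinarith

/-- Numbers of bounded type are badly approximable by rationals. -/
theorem BoundedType.exists_le_abs_sub_rat {α : ℝ} (hα : BoundedType α) :
    ∃ c : ℝ, 0 < c ∧ ∀ q : ℚ, c / (q.den : ℝ) ^ 2 ≤ |α - q| := by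
  obtain ⟨hirr, M, hM⟩ := hα
  have hM1 : 1 ≤ M := by
    rcases h : (GenContFract.of α).partDens.get? 0 with _ | a
    · exact absurd (terminatedAt_iff_partDen_none.2 h) (not_terminatedAt_of_irrational hirr 0)
    · exact (of_one_le_get?_partDen h).trans (hM 0 a h)
  refine ⟨1 / (M + 2), by positivity, fun q => ?_⟩
  have hd : (0 : ℝ) < q.den := by exact_mod_cast q.den_pos
  -- Either the bound is immediate, since `M + 2 ≥ 2`, or Legendre's theorem makes `q` a convergent.
  rcases le_or_gt (1 / (2 * (q.den : ℝ) ^ 2)) |α - q| with h | h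
  · refine le_trans ?_ h
    rw [div_div]
    gcongr
    linarith
  obtain ⟨n, hn⟩ := Real.exists_convs_eq_rat h
  have hBden := dens_le_den_of_convs_eq hirr hn
  have hB : 0 < (GenContFract.of α).dens n :=
    lt_of_lt_of_le (by exact_mod_cast Nat.fib_pos.2 n.succ_pos)
      (succ_nth_fib_le_of_nth_den (Or.inr (not_terminatedAt_of_irrational hirr _)))
  obtain ⟨ifp, hs⟩ : ∃ ifp, IntFractPair.stream α n = some ifp := by
    cases n with
    | zero => exact ⟨_, IntFractPair.stream_zero α⟩
    | succ n =>
      exact Option.ne_none_iff_exists'.1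
        (mt of_terminatedAt_n_iff_succ_nth_intFractPair_stream_eq_none.2
          (not_terminatedAt_of_irrational hirr n))
  have hfr : ifp.fr ≠ 0 := fun h0 =>
    not_terminatedAt_of_irrational hirr n
      (of_terminatedAt_n_iff_succ_nth_intFractPair_stream_eq_none.2
        (IntFractPair.stream_eq_none_of_fr_eq_zero hs h0))
  have hfr0 : 0 < ifp.fr := lt_of_le_of_ne (IntFractPair.nth_stream_fr_nonneg hs) hfr.symm
  have hinv : ifp.fr⁻¹ ≤ M + 1 := by
    have hget := get?_of_eq_some_of_get?_intFractPair_stream_fr_ne_zero hs hfr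
    have := hM n _ (partDen_eq_s_b hget)
    have h2 : ifp.fr⁻¹ < ⌊ifp.fr⁻¹⌋ + 1 := Int.lt_floor_add_one _
    simp only [IntFractPair.of] at this
    linarith
  -- The error of a convergent is `±1 / (B (B / fr + B₋))`. Here `1 / fr ≤ M + 1` and the preceding
  -- denominator satisfies `B₋ ≤ B`, which produces `M + 2`.
  have heq := sub_convs_eq hs
  simp only [if_neg hfr] at heq
  have hBd : ((GenContFract.of α).contsAux (n + 1)).b = (GenContFract.of α).dens n := by
    rw [den_eq_conts_b, nth_cont_eq_succ_nth_contAux]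
  have hp : ((GenContFract.of α).contsAux n).b ≤ (GenContFract.of α).dens n := by
    cases n with
    | zero => simp [contsAux]
    | succ n =>
      have : ((GenContFract.of α).contsAux (n + 1)).b = (GenContFract.of α).dens n := by
        rw [den_eq_conts_b, nth_cont_eq_succ_nth_contAux]
      rw [this]
      exact of_den_mono
  have hp0 : 0 ≤ ((GenContFract.of α).contsAux n).b := zero_le_of_contsAux_b
  rw [hBd, hn] at heq
  rw [heq, abs_div, abs_pow, abs_neg, abs_one, one_pow, abs_of_pos (by positivity), div_div]
  refine one_div_le_one_div_of_le (by positivity) ?_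
  calc (GenContFract.of α).dens n *
        (ifp.fr⁻¹ * (GenContFract.of α).dens n + ((GenContFract.of α).contsAux n).b)
      ≤ (GenContFract.of α).dens n *
        ((M + 1) * (GenContFract.of α).dens n + (GenContFract.of α).dens n) := by gcongr
    _ = (M + 2) * (GenContFract.of α).dens n ^ 2 := by ring
    _ ≤ (M + 2) * (q.den : ℝ) ^ 2 := by gcongr

theorem BoundedType.exists_le_abs_mul_sub_int {α : ℝ} (hα : BoundedType α) :
    ∃ c : ℝ, 0 < c ∧ ∀ k : ℤ, k ≠ 0 → ∀ p : ℤ, c / |(k : ℝ)| ≤ |k * α - p| := by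
  obtain ⟨c, hc, h⟩ := hα.exists_le_abs_sub_rat
  refine ⟨c, hc, fun k hk p => ?_⟩
  have hk' : (k : ℝ) ≠ 0 := by exact_mod_cast hk
  have hka : 0 < |(k : ℝ)| := abs_pos.2 hk'
  have hq := h ((p : ℚ) / k)
  have hden : ((((p : ℚ) / k).den : ℕ) : ℝ) ≤ |(k : ℝ)| := by
    have h1 : ((((p : ℚ) / k).den : ℕ) : ℤ) ∣ k := by
      rw [← Rat.divInt_eq_div]
      exact Rat.den_dvd p k
    have h2 := Int.le_of_dvd (abs_pos.2 hk) ((dvd_abs _ _).2 h1)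
    exact_mod_cast h2
  have hd : (0 : ℝ) < (((p : ℚ) / k).den : ℕ) := by exact_mod_cast Rat.den_pos _
  have heq : |k * α - p| = |(k : ℝ)| * |α - ((p / k : ℚ) : ℝ)| := by
    rw [← abs_mul]
    push_cast
    congr 1
    field_simp
  rw [heq]
  calc c / |(k : ℝ)| = |(k : ℝ)| * (c / |(k : ℝ)| ^ 2) := by field_simp
    _ ≤ |(k : ℝ)| * (c / ((((p : ℚ) / k).den : ℕ) : ℝ) ^ 2) := by gcongr
    _ ≤ _ := by gcongr

end ContinuedFractions

/-! ### Trimming a single term. -/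

theorem exists_trimmedSum_one_eq {X : Type*} (T : X → X) (f : X → ℝ) {N : ℕ} (hN : 1 ≤ N)
    (x : X) : ∃ i ∈ Finset.range N, (∀ n ∈ Finset.range N, f (T^[n] x) ≤ f (T^[i] x)) ∧
      trimmedSum T f 1 N x = ∑ n ∈ (Finset.range N).erase i, f (T^[n] x) := by
  obtain ⟨i, hi, hmax⟩ := Finset.exists_max_image (Finset.range N) (fun n => f (T^[n] x))
    ⟨0, Finset.mem_range.2 hN⟩
  refine ⟨i, hi, hmax, ?_⟩
  have hsup : ∀ h, ((Finset.range N).powersetCard 1).sup' h (fun s => ∑ n ∈ s, f (T^[n] x)) =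
      f (T^[i] x) := by
    intro h
    apply le_antisymm
    · refine Finset.sup'_le _ _ fun s hs => ?_
      rw [Finset.mem_powersetCard] at hs
      obtain ⟨n, rfl⟩ := Finset.card_eq_one.1 hs.2
      simpa using hmax n (hs.1 (by simp))
    · have hmem : {i} ∈ (Finset.range N).powersetCard 1 := by
        simpa [Finset.mem_powersetCard] using hi
      exact (Finset.sum_singleton _ i).ge.trans
        (Finset.le_sup' (fun s => ∑ n ∈ s, f (T^[n] x)) hmem)
  rw [trimmedSum, dif_pos hN, hsup, birkhoffSum, ← Finset.add_sum_erase _ _ hi]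
  ring

/-- Removing the maximum leaves the smallest remainder, so upper bounds may erase whichever time is
convenient, for instance that of the point nearest `0`. -/
theorem trimmedSum_one_le {X : Type*} (T : X → X) (f : X → ℝ) {N i : ℕ} (hi : i < N) (x : X) :
    trimmedSum T f 1 N x ≤ ∑ n ∈ (Finset.range N).erase i, f (T^[n] x) := by
  obtain ⟨j, hj, hmax, h⟩ := exists_trimmedSum_one_eq T f (by omega : 1 ≤ N) x
  have h1 := Finset.add_sum_erase _ (fun n => f (T^[n] x)) hj
  have h2 := Finset.add_sum_erase _ (fun n => f (T^[n] x)) (Finset.mem_range.2 hi)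
  have h3 := hmax i (Finset.mem_range.2 hi)
  rw [h]
  linarith

theorem trimmedSum_one_monotone {X : Type*} (T : X → X) {f : X → ℝ} {x : X}
    (hf : ∀ n, 0 ≤ f (T^[n] x)) :
    Monotone fun N => trimmedSum T f 1 N x := by
  refine monotone_nat_of_le_succ fun N => ?_
  obtain ⟨j, hj, -, h⟩ := exists_trimmedSum_one_eq T f (by omega : 1 ≤ N + 1) x
  rcases Nat.eq_zero_or_pos N with rfl | hN
  -- At `N = 0` the trimmed sum takes its default value `0`.
  · rw [h, trimmedSum, dif_neg (by omega)]
    exact Finset.sum_nonneg fun _ _ => hf _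
  rw [h]
  rcases (Nat.lt_succ_iff_lt_or_eq.1 (Finset.mem_range.1 hj)) with hjN | rfl
  · refine (trimmedSum_one_le T f hjN x).trans ?_
    refine Finset.sum_le_sum_of_subset_of_nonneg ?_ fun _ _ _ => hf _
    exact Finset.erase_subset_erase _ (Finset.range_subset_range.2 N.le_succ)
  · refine (trimmedSum_one_le T f hN x).trans ?_
    refine Finset.sum_le_sum_of_subset_of_nonneg ?_ fun _ _ _ => hf _
    intro n hn
    simp only [Finset.mem_erase, Finset.mem_range] at hn ⊢
    omega

/-! ### Orbits of the rotation and the truncated reciprocal. -/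

theorem rotation_iterate (α : ℝ) {x : ℝ} (hx : x ∈ Ico (0 : ℝ) 1) (n : ℕ) :
    (rotation α)^[n] x = Int.fract (x + n * α) := by
  induction n with
  | zero => simp [Int.fract_eq_self.2 hx]
  | succ n ih =>
    rw [Function.iterate_succ_apply', ih, rotation]
    push_cast
    have : x + (n + 1) * α = Int.fract (x + n * α) + α + ⌊x + n * α⌋ := by
      rw [Int.fract]; ring
    rw [this, Int.fract_add_intCast]

theorem recip_nonneg {y : ℝ} (hy : 0 ≤ y) : 0 ≤ recip y := by
  rw [recip]
  split_ifs <;> positivity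

theorem recip_le_one_div {y : ℝ} (hy : 0 ≤ y) : recip y ≤ 1 / y := by
  rw [recip]
  split_ifs <;> [positivity; rfl]

/-- The function `1 / y` truncated at level `1 / δ`. -/
noncomputable def truncRecip (δ y : ℝ) : ℝ := 1 / max y δ

theorem truncRecip_nonneg {δ : ℝ} (hδ : 0 < δ) (y : ℝ) : 0 ≤ truncRecip δ y :=
  div_nonneg zero_le_one (hδ.le.trans (le_max_right _ _))

theorem truncRecip_le {δ : ℝ} (hδ : 0 < δ) (y : ℝ) : truncRecip δ y ≤ 1 / δ :=
  one_div_le_one_div_of_le hδ (le_max_right _ _)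

theorem truncRecip_of_le {δ y : ℝ} (h : δ ≤ y) : truncRecip δ y = 1 / y := by
  rw [truncRecip, max_eq_left h]

theorem truncRecip_of_ge {δ y : ℝ} (h : y ≤ δ) : truncRecip δ y = 1 / δ := by
  rw [truncRecip, max_eq_right h]

theorem truncRecip_antitone {δ : ℝ} (hδ : 0 < δ) : Antitone (truncRecip δ) := fun _ _ h =>
  one_div_le_one_div_of_le (lt_max_of_lt_right hδ) (max_le_max h le_rfl)

theorem continuous_truncRecip {δ : ℝ} (hδ : 0 < δ) : Continuous (truncRecip δ) := by
  unfold truncRecip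
  exact continuous_const.div (continuous_id.max continuous_const)
    fun y => (lt_max_of_lt_right hδ).ne'

theorem integral_truncRecip {δ : ℝ} (hδ : 0 < δ) (hδ1 : δ ≤ 1) :
    ∫ y in (0 : ℝ)..1, truncRecip δ y = 1 + Real.log (1 / δ) := by
  have hi : ∀ a b, IntervalIntegrable (truncRecip δ) volume a b :=
    fun a b => (continuous_truncRecip hδ).intervalIntegrable a b
  rw [← intervalIntegral.integral_add_adjacent_intervals (hi 0 δ) (hi δ 1)]
  congr 1
  · rw [intervalIntegral.integral_congr (g := fun _ => 1 / δ)]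
    · simp [hδ.ne']
    · intro y hy
      rw [uIcc_of_le hδ.le] at hy
      exact truncRecip_of_ge hy.2
  · rw [intervalIntegral.integral_congr (g := fun y => 1 / y)]
    · exact integral_one_div_of_pos hδ one_pos
    · intro y hy
      rw [uIcc_of_le hδ1] at hy
      exact truncRecip_of_le hy.1

theorem integral_truncRecip_sq_le {δ : ℝ} (hδ : 0 < δ) (hδ1 : δ ≤ 1) :
    ∫ y in (0 : ℝ)..1, truncRecip δ y ^ 2 ≤ 2 / δ := by
  have hi : ∀ a b, IntervalIntegrable (fun y => truncRecip δ y ^ 2) volume a b :=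
    fun a b => ((continuous_truncRecip hδ).pow 2).intervalIntegrable a b
  rw [← intervalIntegral.integral_add_adjacent_intervals (hi 0 δ) (hi δ 1)]
  have h1 : ∫ y in (0 : ℝ)..δ, truncRecip δ y ^ 2 = 1 / δ := by
    rw [intervalIntegral.integral_congr (g := fun _ => (1 / δ) ^ 2)]
    · simp only [intervalIntegral.integral_const, smul_eq_mul, sub_zero]
      field_simp
    · intro y hy
      rw [uIcc_of_le hδ.le] at hy
      simp only [truncRecip_of_ge hy.2]
  have h2 : ∫ y in δ..1, truncRecip δ y ^ 2 = 1 / δ - 1 := by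
    rw [intervalIntegral.integral_congr (g := fun y => y ^ (-2 : ℤ))]
    · rw [integral_zpow]
      · norm_num
        ring
      · right
        refine ⟨by norm_num, ?_⟩
        rw [uIcc_of_le hδ1]
        exact fun h => not_lt.2 h.1 hδ
    · intro y hy
      rw [uIcc_of_le hδ1] at hy
      simp only [truncRecip_of_le hy.1]
      rw [zpow_neg, one_div, inv_pow]
      norm_cast
  rw [h1, h2]
  have : 2 / δ = 1 / δ + 1 / δ := by ring
  linarith

/-- Each visit below `δ` is charged `1/δ`, using only `recip ≥ 0` there, so the convention at the
pole is harmless. The extra `1` pays for the trimmed term. -/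
theorem sum_truncRecip_sub_le_trimmedSum {α x : ℝ} (hx : x ∈ Ico (0 : ℝ) 1) {N : ℕ} (hN : 1 ≤ N)
    {δ : ℝ} (hδ : 0 < δ) :
    ∑ n ∈ Finset.range N, truncRecip δ (Int.fract (x + n * α)) -
      (((Finset.range N).filter fun n : ℕ => Int.fract (x + n * α) < δ).card + 1) / δ ≤
      trimmedSum (rotation α) recip 1 N x := by
  obtain ⟨i, hi, -, h⟩ := exists_trimmedSum_one_eq (rotation α) recip hN x
  simp only [rotation_iterate α hx] at h
  have hterm : ∀ n : ℕ, truncRecip δ (Int.fract (x + n * α)) -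
      (if Int.fract (x + n * α) < δ then 1 / δ else 0) ≤ recip (Int.fract (x + n * α)) := by
    intro n
    split_ifs with hn
    · linarith [truncRecip_le hδ (Int.fract (x + n * α)),
        recip_nonneg (Int.fract_nonneg (x + n * α))]
    · rw [not_lt] at hn
      rw [truncRecip_of_le hn, recip, if_neg (hδ.trans_le hn).ne', sub_zero]
  have hcard : (((Finset.range N).filter fun n : ℕ => Int.fract (x + n * α) < δ).card : ℝ) / δ =
      ∑ n ∈ Finset.range N, if Int.fract (x + n * α) < δ then 1 / δ else 0 := by
    rw [← Finset.sum_filter, Finset.sum_const, nsmul_eq_mul]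
    ring
  have hi0 : (0 : ℝ) ≤ if Int.fract (x + i * α) < δ then 1 / δ else 0 := by
    split_ifs <;> positivity
  rw [h, add_div, hcard, ← sub_sub, ← Finset.sum_sub_distrib, ← Finset.add_sum_erase _ _ hi]
  have h1 := Finset.sum_le_sum (s := (Finset.range N).erase i) fun n _ => hterm n
  have h2 := truncRecip_le hδ (Int.fract (x + i * α))
  linarith

/-! ### Denjoy-Koksma and logarithmic discrepancy. -/

section DenjoyKoksma

variable {g : ℝ → ℝ} {G : ℝ}

theorem abs_sum_range_add_sub_le {F : ℕ → ℝ} (h0 : ∀ n, 0 ≤ F n) (hG : ∀ n, F n ≤ G) (q : ℕ) :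
    |∑ j ∈ Finset.range q, F (j + 1) - ∑ j ∈ Finset.range q, F j| ≤ G := by
  rw [← Finset.sum_sub_distrib, Finset.sum_range_sub, abs_le]
  constructor <;> linarith [h0 q, h0 0, hG q, hG 0]

theorem sum_div_le_and_le (hg : Antitone g) (q : ℕ) (hq : 0 < q) :
    ∑ j ∈ Finset.range q, g (((j : ℝ) + 1) / q) ≤ q * ∫ y in (0 : ℝ)..1, g y ∧
      q * ∫ y in (0 : ℝ)..1, g y ≤ ∑ j ∈ Finset.range q, g ((j : ℝ) / q) := by
  have hq' : (0 : ℝ) < q := by exact_mod_cast hq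
  have hanti : Antitone fun t : ℝ => g (t / q) := fun a b h => hg (by gcongr)
  have hint : ∫ t in (0 : ℝ)..0 + q, g (t / q) = q * ∫ y in (0 : ℝ)..1, g y := by
    rw [intervalIntegral.integral_comp_div _ hq'.ne']
    simp [hq'.ne']
  have h1 := AntitoneOn.sum_le_integral (x₀ := 0) (a := q) (hanti.antitoneOn _)
  have h2 := AntitoneOn.integral_le_sum (x₀ := 0) (a := q) (hanti.antitoneOn _)
  rw [hint] at h1 h2
  simp only [zero_add] at h1 h2
  push_cast at h1
  exact ⟨h1, h2⟩

/-- In a block of `q` steps, where `p / q` is a good approximation of `α`, the orbit of `x` visits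
each interval `[j / q, (j + 1) / q)` about once. -/
theorem exists_fract_orbit_eq {α : ℝ} {r : ℚ} (hr : |α - r| ≤ 1 / (r.den : ℝ) ^ 2) (x : ℝ) {n : ℕ}
    (hn : n < r.den) :
    ∃ e : ℝ, -1 / (r.den : ℝ) < e ∧ e < 2 / r.den ∧
      Int.fract (x + n * α) = Int.fract
        ((((⌊r.den * x⌋ + n * r.num) % r.den : ℤ) : ℝ) / r.den + e) := by
  have hq' : (0 : ℝ) < r.den := by exact_mod_cast r.den_pos
  have hrr : (r : ℝ) = r.num / r.den := by exact_mod_cast (Rat.num_div_den r).symm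
  set q := r.den
  set u := ⌊(q : ℝ) * x⌋
  -- The offset of `x` inside its cell of length `1/q`, plus the drift from replacing `α` by `r`,
  -- which is below `1/q` because `n < q`.
  refine ⟨Int.fract ((q : ℝ) * x) / q + n * (α - r), ?_, ?_, ?_⟩
  · have h1 : 0 ≤ Int.fract ((q : ℝ) * x) / q := div_nonneg (Int.fract_nonneg _) hq'.le
    have h2 : |n * (α - r)| < 1 / q := by
      rw [abs_mul, Nat.abs_cast]
      calc n * |α - r| ≤ n * (1 / (q : ℝ) ^ 2) := by gcongr
        _ < q * (1 / (q : ℝ) ^ 2) := by gcongr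
        _ = 1 / q := by field_simp
    have h3 := (abs_lt.1 h2).1
    rw [neg_div]
    linarith
  · have h1 : Int.fract ((q : ℝ) * x) / q < 1 / q := by
      gcongr
      exact Int.fract_lt_one _
    have h2 : |n * (α - r)| ≤ 1 / q := by
      rw [abs_mul, Nat.abs_cast]
      calc n * |α - r| ≤ n * (1 / (q : ℝ) ^ 2) := by gcongr
        _ ≤ q * (1 / (q : ℝ) ^ 2) := by gcongr
        _ = 1 / q := by field_simp
    have h3 := (abs_le.1 h2).2
    have : 2 / (q : ℝ) = 1 / q + 1 / q := by ring
    linarith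
  · have hx : x = (u + Int.fract ((q : ℝ) * x)) / q := by
      rw [Int.floor_add_fract]
      field_simp
    have hmod : (((u + n * r.num) % q : ℤ) : ℝ) = u + n * r.num - q * ((u + n * r.num) / q : ℤ) := by
      rw [Int.emod_def]
      push_cast
      ring
    rw [hmod, Int.fract_eq_fract]
    refine ⟨((u + n * r.num) / q : ℤ), ?_⟩
    rw [hrr]
    nth_rw 1 [hx]
    field_simp
    ring

/-- The numerator is invertible modulo the denominator, so `n ↦ u + n * r.num` permutes the
residues. -/
theorem sum_comp_add_mul_emod {r : ℚ} (u : ℤ) :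
    ∀ F : ℕ → ℝ, ∑ n ∈ Finset.range r.den, F (((u + n * r.num) % r.den : ℤ).toNat) =
      ∑ j ∈ Finset.range r.den, F j := by
  intro F
  have hq : (0 : ℤ) < r.den := by exact_mod_cast r.den_pos
  have hinj : Set.InjOn (fun n : ℕ => ((u + n * r.num) % r.den : ℤ).toNat)
      (Finset.range r.den : Set ℕ) := by
    intro a ha b hb hab
    simp only [Finset.coe_range, Set.mem_Iio] at ha hb
    have h1 : (u + a * r.num) % r.den = (u + b * r.num) % (r.den : ℤ) := by
      have := congrArg (fun n : ℕ => (n : ℤ)) hab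
      simpa only [Int.toNat_of_nonneg (Int.emod_nonneg _ hq.ne')] using this
    have h2 : (r.den : ℤ) ∣ (b - a) * r.num := by
      have h3 := Int.ModEq.dvd (show (u + a * r.num) ≡ (u + b * r.num) [ZMOD r.den] from h1)
      convert h3 using 1
      ring
    have hcop : IsCoprime (r.den : ℤ) r.num :=
      (Int.isCoprime_iff_gcd_eq_one.2 (by simpa [Int.gcd] using r.reduced)).symm
    have h3 := hcop.dvd_of_dvd_mul_right h2
    have h4 : ((b : ℤ) - a) = 0 := Int.eq_zero_of_abs_lt_dvd h3 (by rw [abs_lt]; omega)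
    omega
  have himg : (Finset.range r.den).image (fun n : ℕ => ((u + n * r.num) % r.den : ℤ).toNat) =
      Finset.range r.den := by
    apply Finset.eq_of_subset_of_card_le
    · intro j hj
      obtain ⟨n, -, rfl⟩ := Finset.mem_image.1 hj
      have := Int.emod_lt_of_pos (u + n * r.num) hq
      have := Int.emod_nonneg (u + n * r.num) hq.ne'
      simp only [Finset.mem_range]
      omega
    · rw [Finset.card_image_of_injOn hinj]
  conv_rhs => rw [← himg]
  rw [Finset.sum_image hinj]

/-- The Denjoy-Koksma inequality for a bounded monotone function. -/
theorem abs_sum_sub_integral_le_of_abs_sub_rat_le (hg : Antitone g) (h0 : ∀ y, 0 ≤ g y)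
    (hG : ∀ y, g y ≤ G) {α : ℝ} {r : ℚ} (hr : |α - r| ≤ 1 / (r.den : ℝ) ^ 2) (x : ℝ) :
    |∑ n ∈ Finset.range r.den, g (Int.fract (x + n * α)) - r.den * ∫ y in (0 : ℝ)..1, g y| ≤
      3 * G := by
  have hq : (0 : ℤ) < r.den := by exact_mod_cast r.den_pos
  have hq' : (0 : ℝ) < r.den := by exact_mod_cast r.den_pos
  set q := r.den
  set J : ℕ → ℕ := fun n => ((⌊(q : ℝ) * x⌋ + n * r.num) % q : ℤ).toNat
  have hJ : ∀ n : ℕ, (((⌊(q : ℝ) * x⌋ + n * r.num) % q : ℤ) : ℝ) = (J n : ℝ) := fun n => by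
    have : (((⌊(q : ℝ) * x⌋ + n * r.num) % q : ℤ)) = (J n : ℤ) :=
      (Int.toNat_of_nonneg (Int.emod_nonneg _ hq.ne')).symm
    rw [this, Int.cast_natCast]
  have hJq : ∀ n, J n < q := fun n => by
    have := Int.emod_lt_of_pos (⌊(q : ℝ) * x⌋ + n * r.num) hq
    have := Int.emod_nonneg (⌊(q : ℝ) * x⌋ + n * r.num) hq.ne'
    simp only [J]
    omega
  have hsum := sum_comp_add_mul_emod (r := r) ⌊(q : ℝ) * x⌋
  have hG0 : 0 ≤ G := (h0 0).trans (hG 0)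
  -- Only the last cell can wrap past `1` and spoil this bound; wrapping below `0` merely increases
  -- the fractional part. In `hlow` the exceptional cell is the first one.
  have hup : ∀ n ∈ Finset.range q, g (Int.fract (x + n * α)) ≤
      g (((J n : ℝ) - 1) / q) + if J n = q - 1 then G else 0 := by
    intro n hn
    obtain ⟨e, he1, he2, he⟩ := exists_fract_orbit_eq hr x (Finset.mem_range.1 hn)
    rw [hJ] at he
    split_ifs with hlast
    · linarith [h0 (((J n : ℝ) - 1) / q), hG (Int.fract (x + n * α))]
    · rw [add_zero]
      apply hg
      rw [he]
      have hlt : (J n : ℝ) / q + e < 1 := by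
        have : (J n : ℝ) + 2 ≤ q := by
          have := hJq n
          exact_mod_cast (by omega : J n + 2 ≤ q)
        calc (J n : ℝ) / q + e < (J n : ℝ) / q + 2 / q := by gcongr
          _ = ((J n : ℝ) + 2) / q := by ring
          _ ≤ 1 := by rw [div_le_one hq']; exact this
      have hfl : ⌊(J n : ℝ) / q + e⌋ ≤ 0 := by
        rw [← Int.lt_add_one_iff, Int.floor_lt]
        simpa using hlt
      have hfl' : ((⌊(J n : ℝ) / q + e⌋ : ℤ) : ℝ) ≤ 0 := by exact_mod_cast hfl
      have : ((J n : ℝ) - 1) / q = (J n : ℝ) / q + -1 / q := by ring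
      rw [this, Int.fract]
      linarith
  have hlow : ∀ n ∈ Finset.range q, g (((J n : ℝ) + 2) / q) - (if J n = 0 then G else 0) ≤
      g (Int.fract (x + n * α)) := by
    intro n hn
    obtain ⟨e, he1, he2, he⟩ := exists_fract_orbit_eq hr x (Finset.mem_range.1 hn)
    rw [hJ] at he
    split_ifs with hzero
    · linarith [hG (((J n : ℝ) + 2) / q), h0 (Int.fract (x + n * α))]
    · rw [sub_zero]
      apply hg
      rw [he]
      have hnn : 0 ≤ (J n : ℝ) / q + e := by
        have : (1 : ℝ) ≤ J n := by exact_mod_cast Nat.one_le_iff_ne_zero.2 hzero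
        calc (0 : ℝ) ≤ ((J n : ℝ) - 1) / q := div_nonneg (by linarith) hq'.le
          _ = (J n : ℝ) / q + -1 / q := by ring
          _ ≤ _ := by gcongr
      have hfl' : (0 : ℝ) ≤ ((⌊(J n : ℝ) / q + e⌋ : ℤ) : ℝ) := by
        exact_mod_cast Int.floor_nonneg.2 hnn
      have : ((J n : ℝ) + 2) / q = (J n : ℝ) / q + 2 / q := by ring
      rw [this, Int.fract]
      linarith
  have hup' := Finset.sum_le_sum hup
  have hlow' := Finset.sum_le_sum hlow
  rw [hsum fun j => g (((j : ℝ) - 1) / q) + if j = q - 1 then G else 0,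
    Finset.sum_add_distrib, Finset.sum_ite_eq' (Finset.range q) (q - 1),
    if_pos (Finset.mem_range.2 (by omega))] at hup'
  rw [hsum fun j => g (((j : ℝ) + 2) / q) - if j = 0 then G else 0,
    Finset.sum_sub_distrib, Finset.sum_ite_eq' (Finset.range q) 0,
    if_pos (Finset.mem_range.2 (by omega))] at hlow'
  obtain ⟨hi1, hi2⟩ := sum_div_le_and_le hg q r.den_pos
  -- In each direction the error `3 * G` consists of one exceptional cell and two index shifts,
  -- needed to reach the Riemann sum on the right side of the integral.
  have shift : ∀ a : ℝ, |∑ j ∈ Finset.range q, g (((j : ℝ) + (a + 1)) / q) -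
      ∑ j ∈ Finset.range q, g (((j : ℝ) + a) / q)| ≤ G := fun a => by
    have := abs_sum_range_add_sub_le (F := fun j => g (((j : ℝ) + a) / q)) (fun _ => h0 _)
      (fun _ => hG _) q
    push_cast at this
    simpa only [add_assoc, add_comm (1 : ℝ) a] using this
  have s1 := abs_le.1 (shift (-1))
  have s2 := abs_le.1 (shift 0)
  have s3 := abs_le.1 (shift 1)
  norm_num only [add_zero, zero_add, ← sub_eq_add_neg] at s1 s2 s3
  rw [abs_le]
  constructor <;> linarith [s1.1, s1.2, s2.1, s2.2, s3.1, s3.2]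

/-- For a badly approximable rotation, the discrepancy of a bounded monotone function grows at most
logarithmically. -/
theorem abs_sum_sub_integral_le (hg : Antitone g) (h0 : ∀ y, 0 ≤ g y) (hG : ∀ y, g y ≤ G)
    {α c : ℝ} (hc : 0 < c) (hα : ∀ r : ℚ, c / (r.den : ℝ) ^ 2 ≤ |α - r|) (L : ℕ) :
    ∀ N < 2 ^ L, ∀ x : ℝ,
      |∑ n ∈ Finset.range N, g (Int.fract (x + n * α)) - N * ∫ y in (0 : ℝ)..1, g y| ≤
        3 * G / c * L := by
  have hG0 : 0 ≤ G := (h0 0).trans (hG 0)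
  set I := ∫ y in (0 : ℝ)..1, g y
  induction L with
  | zero =>
    intro N hN x
    obtain rfl : N = 0 := by omega
    simp
  | succ L ih =>
    intro N hN x
    rcases Nat.eq_zero_or_pos N with rfl | hNpos
    · simp only [Finset.range_zero, Finset.sum_empty, Nat.cast_zero, zero_mul, sub_zero, abs_zero]
      positivity
    -- Dirichlet's approximation at scale `N`. Compared with the lower bound `c / r.den ^ 2` it
    -- forces `c * (N + 1) ≤ r.den`, hence at most `1 / c` full blocks.
    obtain ⟨r, hr, hrN⟩ := Real.exists_rat_abs_sub_le_and_den_le α hNpos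
    have hq' : (0 : ℝ) < r.den := by exact_mod_cast r.den_pos
    have hN' : (0 : ℝ) < N := by exact_mod_cast hNpos
    have hrN' : (r.den : ℝ) ≤ N := by exact_mod_cast hrN
    have hr2 : |α - r| ≤ 1 / (r.den : ℝ) ^ 2 := by
      refine hr.trans (one_div_le_one_div_of_le (by positivity) ?_)
      nlinarith
    have hblocks : ((N / r.den : ℕ) : ℝ) ≤ 1 / c := by
      have h1 := (hα r).trans hr
      rw [div_le_div_iff₀ (by positivity) (by positivity)] at h1
      have h2 : c * (N + 1) ≤ r.den := by nlinarith
      calc ((N / r.den : ℕ) : ℝ) ≤ N / r.den := Nat.cast_div_le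
        _ ≤ 1 / c := by
          rw [div_le_div_iff₀ hq' hc]
          nlinarith
    have hblock : ∀ b : ℕ, ∀ x : ℝ,
        |∑ n ∈ Finset.range (b * r.den), g (Int.fract (x + n * α)) - (b * r.den : ℕ) * I| ≤
          b * (3 * G) := by
      intro b
      induction b with
      | zero => simp
      | succ b ihb =>
        intro x
        have h1 := ihb x
        have h2 := abs_sum_sub_integral_le_of_abs_sub_rat_le hg h0 hG hr2 (x + (b * r.den : ℕ) * α)
        rw [add_mul, one_mul, Finset.sum_range_add]
        have h3 : ∀ n : ℕ, x + ((b * r.den + n : ℕ) : ℝ) * α = x + (b * r.den : ℕ) * α + n * α :=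
          fun n => by push_cast; ring
        simp only [h3]
        rw [abs_le] at h1 h2 ⊢
        push_cast at h1 h2 ⊢
        constructor <;> linarith [h1.1, h1.2, h2.1, h2.2]
    -- Since `r.den ≤ N`, the remainder is less than half of `N`: one binary digit per induction
    -- step.
    have hmod : N % r.den < 2 ^ L := by
      have h1 := Nat.mod_lt N r.den_pos
      have h2 := Nat.div_add_mod N r.den
      have h3 : 1 ≤ N / r.den := Nat.div_pos hrN r.den_pos
      have h4 : r.den * 1 ≤ r.den * (N / r.den) := Nat.mul_le_mul_left _ h3
      rw [pow_succ] at hN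
      omega
    have h1 := hblock (N / r.den) x
    have h2 := ih (N % r.den) hmod (x + ((N / r.den) * r.den : ℕ) * α)
    have h3 : ∀ n : ℕ, x + (((N / r.den) * r.den + n : ℕ) : ℝ) * α =
        x + ((N / r.den) * r.den : ℕ) * α + n * α := fun n => by push_cast; ring
    have h4 : ((N / r.den : ℕ) : ℝ) * (3 * G) ≤ 3 * G / c := by
      calc ((N / r.den : ℕ) : ℝ) * (3 * G) ≤ 1 / c * (3 * G) := by gcongr
        _ = 3 * G / c := by ring
    have h5 : (N : ℝ) = ((N / r.den) * r.den : ℕ) + (N % r.den : ℕ) := by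
      exact_mod_cast (Nat.div_add_mod' N r.den).symm
    have h6 : ∑ n ∈ Finset.range N, g (Int.fract (x + n * α)) =
        ∑ n ∈ Finset.range ((N / r.den) * r.den), g (Int.fract (x + n * α)) +
        ∑ n ∈ Finset.range (N % r.den),
          g (Int.fract (x + ((N / r.den) * r.den : ℕ) * α + n * α)) := by
      conv_lhs => rw [← Nat.div_add_mod' N r.den, Finset.sum_range_add]
      simp only [h3]
    rw [h6, h5]
    rw [abs_le] at h1 h2 ⊢
    push_cast at h1 h2 ⊢
    constructor <;> linarith [h1.1, h1.2, h2.1, h2.2]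

end DenjoyKoksma

/-! ### The uniform law for bounded type. -/

section BoundedTypeLaw

variable {α c : ℝ}

theorem div_le_abs_fract_sub_fract (hc : 0 < c)
    (hα : ∀ k : ℤ, k ≠ 0 → ∀ p : ℤ, c / |(k : ℝ)| ≤ |k * α - p|) (x : ℝ) {N m n : ℕ}
    (hm : m < N) (hn : n < N) (hmn : m ≠ n) :
    c / N ≤ |Int.fract (x + m * α) - Int.fract (x + n * α)| := by
  have hk : (m : ℤ) - n ≠ 0 := by omega
  have h := hα _ hk (⌊x + m * α⌋ - ⌊x + n * α⌋)
  have hk' : |(((m : ℤ) - n : ℤ) : ℝ)| ≤ N := by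
    have : |(m : ℤ) - n| ≤ N := by rw [abs_le]; omega
    exact_mod_cast this
  have hpos : 0 < |(((m : ℤ) - n : ℤ) : ℝ)| := abs_pos.2 (by exact_mod_cast hk)
  calc c / N ≤ c / |(((m : ℤ) - n : ℤ) : ℝ)| := by gcongr
    _ ≤ _ := h
    _ = _ := by
      congr 1
      rw [Int.fract, Int.fract]
      push_cast
      ring

/-- Distinct orbit points are at least `c / N` apart, so a half-open cell of that length contains at
most one. -/
theorem injOn_floor_fract_mul (hc : 0 < c)
    (hα : ∀ k : ℤ, k ≠ 0 → ∀ p : ℤ, c / |(k : ℝ)| ≤ |k * α - p|) (x : ℝ) (N : ℕ) :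
    Set.InjOn (fun n : ℕ => ⌊Int.fract (x + n * α) * N / c⌋₊) (Finset.range N : Set ℕ) := by
  intro m hm n hn hmn
  simp only [Finset.coe_range, Set.mem_Iio] at hm hn
  by_contra hne
  have h := div_le_abs_fract_sub_fract hc hα x hm hn hne
  have hN : (0 : ℝ) < N := by exact_mod_cast (Nat.zero_le m).trans_lt hm
  have hpos : ∀ k : ℕ, 0 ≤ Int.fract (x + k * α) * N / c := fun k =>
    div_nonneg (mul_nonneg (Int.fract_nonneg _) hN.le) hc.le
  have h1 := Nat.floor_le (hpos m)
  have h2 := Nat.lt_floor_add_one (Int.fract (x + m * α) * N / c)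
  have h3 := Nat.floor_le (hpos n)
  have h4 := Nat.lt_floor_add_one (Int.fract (x + n * α) * N / c)
  simp only at hmn
  rw [hmn] at h1 h2
  have h5 : |Int.fract (x + m * α) * N / c - Int.fract (x + n * α) * N / c| < 1 := by
    rw [abs_lt]
    constructor <;> linarith
  have h6 : Int.fract (x + m * α) * N / c - Int.fract (x + n * α) * N / c =
      (Int.fract (x + m * α) - Int.fract (x + n * α)) * (N / c) := by ring
  rw [h6, abs_mul, abs_of_pos (div_pos hN hc)] at h5
  have h7 : c / N * (N / c) ≤ _ := mul_le_mul_of_nonneg_right h (div_pos hN hc).le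
  have h8 : c / N * (N / c) = 1 := by field_simp
  linarith

theorem card_fract_lt_le (hc : 0 < c)
    (hα : ∀ k : ℤ, k ≠ 0 → ∀ p : ℤ, c / |(k : ℝ)| ≤ |k * α - p|) (x : ℝ) (N : ℕ) {δ : ℝ}
    (hδ : 0 < δ) :
    (((Finset.range N).filter fun n : ℕ => Int.fract (x + n * α) < δ).card : ℝ) ≤
      δ * N / c + 1 := by
  have h : ((Finset.range N).filter fun n : ℕ => Int.fract (x + n * α) < δ).card ≤
      (Finset.range (⌊δ * N / c⌋₊ + 1)).card := by
    refine Finset.card_le_card_of_injOn (fun n : ℕ => ⌊Int.fract (x + n * α) * N / c⌋₊) ?_ ?_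
    · intro n hn
      simp only [Finset.coe_filter, Finset.mem_range, Set.mem_ofPred_eq] at hn
      simp only [Finset.coe_range, Set.mem_Iio, Nat.lt_succ_iff]
      apply Nat.floor_le_floor
      gcongr
      exact hn.2.le
    · exact (injOn_floor_fract_mul hc hα x N).mono (Finset.coe_subset.2 (Finset.filter_subset _ _))
  rw [Finset.card_range] at h
  have h2 := Nat.floor_le (a := δ * N / c) (by positivity)
  have h3 : (((Finset.range N).filter fun n : ℕ => Int.fract (x + n * α) < δ).card : ℝ) ≤
    ⌊δ * N / c⌋₊ + 1 := by exact_mod_cast h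
  linarith

/-- Once the point nearest `0` is erased, separation puts the others at distance at least `c / N`
from `0`. Their cell indices are then distinct positive integers, and the sum is dominated by `N /
c` times a harmonic sum. -/
theorem sum_one_div_fract_le (hc : 0 < c)
    (hα : ∀ k : ℤ, k ≠ 0 → ∀ p : ℤ, c / |(k : ℝ)| ≤ |k * α - p|) (x : ℝ) {N i : ℕ} {δ : ℝ}
    (hδ : 1 ≤ δ * N / c) (hi : i < N)
    (hmin : ∀ n < N, Int.fract (x + i * α) ≤ Int.fract (x + n * α)) :
    ∑ n ∈ ((Finset.range N).erase i).filter (fun n : ℕ => Int.fract (x + n * α) < δ),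
      1 / Int.fract (x + n * α) ≤ N / c * (1 + Real.log (δ * N / c)) := by
  have hN : (0 : ℝ) < N := by exact_mod_cast (Nat.zero_le i).trans_lt hi
  set s := ((Finset.range N).erase i).filter (fun n : ℕ => Int.fract (x + n * α) < δ) with hs
  set φ : ℕ → ℕ := fun n => ⌊Int.fract (x + n * α) * N / c⌋₊ with hφ
  have hmem : ∀ n ∈ s, n < N ∧ n ≠ i ∧ Int.fract (x + n * α) < δ := fun n hn => by
    simp only [hs, Finset.mem_filter, Finset.mem_erase, Finset.mem_range] at hn
    exact ⟨hn.1.2, hn.1.1, hn.2⟩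
  have hge : ∀ n ∈ s, 1 ≤ Int.fract (x + n * α) * N / c := fun n hn => by
    obtain ⟨hnN, hni, -⟩ := hmem n hn
    have h := div_le_abs_fract_sub_fract hc hα x hnN hi hni
    rw [abs_of_nonneg (sub_nonneg.2 (hmin n hnN))] at h
    have h2 : c / N ≤ Int.fract (x + n * α) := by linarith [Int.fract_nonneg (x + i * α)]
    rw [div_le_iff₀ hN] at h2
    rwa [one_le_div hc]
  have hφ1 : ∀ n ∈ s, 1 ≤ φ n := fun n hn => Nat.le_floor (by simpa using hge n hn)
  calc ∑ n ∈ s, 1 / Int.fract (x + n * α) ≤ ∑ n ∈ s, N / c * ((φ n : ℝ))⁻¹ := by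
        refine Finset.sum_le_sum fun n hn => ?_
        have h1 : (φ n : ℝ) ≤ Int.fract (x + n * α) * N / c :=
          Nat.floor_le (zero_le_one.trans (hge n hn))
        have h2 : (0 : ℝ) < φ n := by exact_mod_cast hφ1 n hn
        have h3 : 1 / Int.fract (x + n * α) = N / c * (Int.fract (x + n * α) * N / c)⁻¹ := by
          rcases eq_or_ne (Int.fract (x + n * α)) 0 with h0 | h0
          · simp [h0]
          · field_simp
        rw [h3]
        gcongr
    _ = N / c * ∑ j ∈ s.image φ, ((j : ℝ))⁻¹ := by
        rw [← Finset.mul_sum, Finset.sum_image]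
        refine (injOn_floor_fract_mul hc hα x N).mono ?_
        intro n hn
        simpa using (hmem n hn).1
    _ ≤ N / c * ∑ j ∈ Finset.Icc 1 ⌊δ * N / c⌋₊, ((j : ℝ))⁻¹ := by
        gcongr
        intro j hj
        obtain ⟨n, hn, rfl⟩ := Finset.mem_image.1 hj
        refine Finset.mem_Icc.2 ⟨hφ1 n hn, Nat.floor_le_floor ?_⟩
        gcongr
        exact (hmem n hn).2.2.le
    _ ≤ N / c * (1 + Real.log (δ * N / c)) := by
        gcongr
        have := harmonic_floor_le_one_add_log (δ * N / c) hδ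
        rw [harmonic_eq_sum_Icc] at this
        push_cast at this
        exact this

theorem trimmedSum_le_of_separated (hc : 0 < c)
    (hα : ∀ k : ℤ, k ≠ 0 → ∀ p : ℤ, c / |(k : ℝ)| ≤ |k * α - p|) {x : ℝ}
    (hx : x ∈ Ico (0 : ℝ) 1) {N : ℕ} (hN : 1 ≤ N) {δ : ℝ} (hδ0 : 0 < δ) (hδ : 1 ≤ δ * N / c) :
    trimmedSum (rotation α) recip 1 N x ≤
      ∑ n ∈ Finset.range N, truncRecip δ (Int.fract (x + n * α)) +
        N / c * (1 + Real.log (δ * N / c)) := by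
  obtain ⟨i, hi, hmin⟩ := Finset.exists_min_image (Finset.range N)
    (fun n : ℕ => Int.fract (x + n * α)) ⟨0, Finset.mem_range.2 hN⟩
  have h := trimmedSum_one_le (rotation α) recip (Finset.mem_range.1 hi) x
  simp only [rotation_iterate α hx] at h
  have hsmall := sum_one_div_fract_le hc hα x hδ (Finset.mem_range.1 hi)
    fun n hn => hmin n (Finset.mem_range.2 hn)
  refine h.trans ((Finset.sum_le_sum fun n _ => ?_).trans
    (b := ∑ n ∈ (Finset.range N).erase i, (truncRecip δ (Int.fract (x + n * α)) +
      if Int.fract (x + n * α) < δ then 1 / Int.fract (x + n * α) else 0)) ?_)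
  · split_ifs with hn
    · linarith [truncRecip_nonneg hδ0 (Int.fract (x + n * α)),
        recip_le_one_div (Int.fract_nonneg (x + n * α))]
    · rw [truncRecip_of_le (not_lt.1 hn), add_zero]
      exact recip_le_one_div (Int.fract_nonneg _)
  · rw [Finset.sum_add_distrib, ← Finset.sum_filter]
    refine add_le_add (Finset.sum_le_sum_of_subset_of_nonneg (Finset.erase_subset _ _)
      fun _ _ _ => truncRecip_nonneg hδ0 _) hsmall

theorem BoundedType.exists_abs_trimmedSum_sub_le (h : BoundedType α) :
    ∃ K K' : ℝ, ∀ᶠ N : ℕ in atTop, ∀ x ∈ Ico (0 : ℝ) 1,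
      |trimmedSum (rotation α) recip 1 N x - N * Real.log N| ≤
        N * (K + K' * Real.log (Real.log N)) := by
  obtain ⟨c, hc, hα⟩ := h.exists_le_abs_mul_sub_int
  obtain ⟨d, hd, hr⟩ := h.exists_le_abs_sub_rat
  -- The `1` in each constant comes from the integral, `9 / d` from the discrepancy, `1 / c + 2`
  -- from visits below `δ` and the trimmed term, and the remaining multiples of `1 / c` from the
  -- harmonic sum.
  refine ⟨1 + 9 / d + 1 / c + 2 + 1 / c * (1 - Real.log c), 1 + 1 / c, ?_⟩
  have hlogtop : Tendsto (fun N : ℕ => Real.log N) atTop atTop :=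
    Real.tendsto_log_atTop.comp tendsto_natCast_atTop_atTop
  filter_upwards [hlogtop.eventually_ge_atTop (max 1 c), eventually_ge_atTop 1] with N hlog hN x hx
  have hlog1 : 1 ≤ Real.log N := (le_max_left _ _).trans hlog
  have hlogc : c ≤ Real.log N := (le_max_right _ _).trans hlog
  have hN0 : (0 : ℝ) < N := by exact_mod_cast hN
  have hlog0 : 0 < Real.log N := by linarith
  -- With this choice `1 / δ` cancels the logarithm in the discrepancy, while the harmonic sum has
  -- only about `log N / c` terms.
  set δ := Real.log N / N with hδ
  have hδ0 : 0 < δ := by positivity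
  have hδ1 : δ ≤ 1 := by
    rw [hδ, div_le_one hN0]
    linarith [Real.log_le_sub_one_of_pos hN0]
  have hδN : δ * N = Real.log N := by rw [hδ]; field_simp
  have h1δ : 1 / δ = N / Real.log N := by rw [hδ, one_div_div]
  have hint : ∫ y in (0 : ℝ)..1, truncRecip δ y = 1 + Real.log N - Real.log (Real.log N) := by
    rw [integral_truncRecip hδ0 hδ1, h1δ, Real.log_div hN0.ne' hlog0.ne']
    ring
  have hL : ((Nat.log 2 N + 1 : ℕ) : ℝ) ≤ 3 * Real.log N := by
    have h1 : (Nat.log 2 N : ℝ) * Real.log 2 ≤ Real.log N := by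
      rw [← Real.log_pow]
      apply Real.log_le_log (by positivity)
      exact_mod_cast Nat.pow_log_le_self 2 (by omega)
    have h2 := Real.log_two_gt_d9
    push_cast
    nlinarith
  have hdisc := abs_sum_sub_integral_le (truncRecip_antitone hδ0) (truncRecip_nonneg hδ0)
    (truncRecip_le hδ0) hd hr (Nat.log 2 N + 1) N (Nat.lt_pow_succ_log_self (by norm_num) N) x
  have hdisc2 : 3 * (1 / δ) / d * ((Nat.log 2 N + 1 : ℕ) : ℝ) ≤ N * (9 / d) := by
    calc 3 * (1 / δ) / d * ((Nat.log 2 N + 1 : ℕ) : ℝ)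
        ≤ 3 * (1 / δ) / d * (3 * Real.log N) := by gcongr
      _ = N * (9 / d) := by rw [h1δ]; field_simp; norm_num
  have hlow := sum_truncRecip_sub_le_trimmedSum (α := α) hx hN hδ0
  have hcard := card_fract_lt_le hc hα x N hδ0
  have hup := trimmedSum_le_of_separated hc hα hx hN hδ0 (by rw [hδN, one_le_div hc]; exact hlogc)
  rw [hδN] at hcard hup
  rw [Real.log_div hlog0.ne' hc.ne'] at hup
  have hlow2 : ((((Finset.range N).filter fun n : ℕ => Int.fract (x + n * α) < δ).card : ℝ) + 1) / δ
      ≤ N * (1 / c + 2) := by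
    calc _ ≤ (Real.log N / c + 1 + 1) / δ := by gcongr
      _ = (Real.log N / c + 2) * (1 / δ) := by ring
      _ = N * (1 / c) + 2 * N / Real.log N := by rw [h1δ]; field_simp
      _ ≤ N * (1 / c) + 2 * N := by
        gcongr
        exact div_le_self (by positivity) hlog1
      _ = _ := by ring
  have hloglog : 0 ≤ Real.log (Real.log N) := Real.log_nonneg hlog1
  rw [hint] at hdisc
  have hd1 := abs_le.1 (hdisc.trans hdisc2)
  have hp1 : 0 ≤ N * Real.log (Real.log N) := by positivity
  have hp2 : 0 ≤ N * (1 / c) * Real.log (Real.log N) := by positivity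
  have hp3 : 0 ≤ N * (1 / c) * (1 + (Real.log (Real.log N) - Real.log c)) := by
    rw [← Real.log_div hlog0.ne' hc.ne']
    have := Real.log_nonneg ((one_le_div hc).2 hlogc)
    positivity
  have hp4 : (0 : ℝ) ≤ N * (1 / c) := by positivity
  have hp5 : (N : ℝ) / c = N * (1 / c) := by ring
  rw [hp5] at hup
  rw [abs_le]
  constructor <;> nlinarith [hd1.1, hd1.2]

theorem tendsto_const_add_log_log_div_log (K K' : ℝ) :
    Tendsto (fun N : ℕ => (K + K' * Real.log (Real.log N)) / Real.log N) atTop (𝓝 0) := by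
  have hlogtop : Tendsto (fun N : ℕ => Real.log N) atTop atTop :=
    Real.tendsto_log_atTop.comp tendsto_natCast_atTop_atTop
  have h1 : Tendsto (fun t : ℝ => (K + K' * Real.log t) / t) atTop (𝓝 0) := by
    have h2 : Tendsto (fun t : ℝ => Real.log t / t) atTop (𝓝 0) :=
      Real.isLittleO_log_id_atTop.tendsto_div_nhds_zero
    have h3 : Tendsto (fun t : ℝ => K / t) atTop (𝓝 0) := tendsto_const_nhds.div_atTop tendsto_id
    have := h3.add (h2.const_mul K')
    simp only [mul_zero, add_zero] at this
    exact this.congr fun t => by ring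
  exact h1.comp hlogtop

/-- The lightly trimmed law for rotation numbers of bounded type, uniformly in the starting point. -/
theorem BoundedType.tendstoUniformlyOn_trimmedSum (h : BoundedType α) :
    TendstoUniformlyOn (fun (N : ℕ) (x : ℝ) =>
      trimmedSum (rotation α) recip 1 N x / ((N : ℝ) * Real.log N)) (fun _ => 1) atTop
      (Ico (0 : ℝ) 1) := by
  obtain ⟨K, K', hK⟩ := h.exists_abs_trimmedSum_sub_le
  rw [Metric.tendstoUniformlyOn_iff]
  intro ε hε
  filter_upwards [hK, (tendsto_const_add_log_log_div_log K K').eventually_lt_const hε,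
    eventually_ge_atTop 2] with N hN hlt hN2 x hx
  have hN0 : (0 : ℝ) < N := by positivity
  have hlog : 0 < Real.log N := Real.log_pos (by exact_mod_cast hN2)
  rw [dist_comm, Real.dist_eq, div_sub_one (by positivity), abs_div,
    abs_of_pos (a := (N : ℝ) * Real.log N) (by positivity)]
  refine lt_of_le_of_lt ?_ hlt
  calc _ ≤ N * (K + K' * Real.log (Real.log N)) / (N * Real.log N) := by
        gcongr
        exact hN x hx
    _ = _ := by field_simp

end BoundedTypeLaw

/-! ### Pairwise independence along a random rotation. -/

section RandomRotation

open ProbabilityTheory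

/-- The uniform distribution on the unit interval. -/
noncomputable def unif : Measure ℝ := volume.restrict (Ioc (0 : ℝ) 1)

instance : IsProbabilityMeasure unif := ⟨by simp [unif]⟩

theorem measurePreserving_mk_unif :
    MeasurePreserving ((↑) : ℝ → UnitAddCircle) unif volume := by
  simpa [unif] using UnitAddCircle.measurePreserving_mk 0

theorem ae_unif_mem_Ico : ∀ᵐ x ∂unif, x ∈ Ico (0 : ℝ) 1 := by
  rw [unif, ← restrict_Ico_eq_restrict_Ioc]
  exact ae_restrict_mem measurableSet_Ico

theorem integral_unif (g : ℝ → ℝ) : ∫ y, g y ∂unif = ∫ y in (0 : ℝ)..1, g y := by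
  rw [intervalIntegral.integral_of_le zero_le_one, unif]

theorem measurePreserving_equivIco :
    MeasurePreserving (fun y : UnitAddCircle => (AddCircle.equivIco 1 0 y : ℝ)) volume unif := by
  have hm : Measurable fun y : UnitAddCircle => (AddCircle.equivIco 1 0 y : ℝ) :=
    measurable_subtype_coe.comp (AddCircle.measurableEquivIco 1 0).measurable
  refine ⟨hm, ?_⟩
  rw [← measurePreserving_mk_unif.map_eq, Measure.map_map hm measurePreserving_mk_unif.measurable]
  conv_rhs => rw [← Measure.map_id (μ := unif)]
  refine Measure.map_congr ?_
  filter_upwards [ae_unif_mem_Ico] with x hx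
  simp only [Function.comp, id]
  rw [AddCircle.equivIco_coe_eq (by simpa using hx)]

theorem equivIco_coe_eq_fract (y : ℝ) :
    (AddCircle.equivIco 1 0 (y : UnitAddCircle) : ℝ) = Int.fract y := by
  have : (y : UnitAddCircle) = (Int.fract y : ℝ) := by
    rw [← sub_eq_zero, ← AddCircle.coe_sub, Int.self_sub_fract]
    exact (AddCircle.coe_eq_zero_iff 1).2 ⟨⌊y⌋, by simp⟩
  rw [this, AddCircle.equivIco_coe_eq
    ⟨Int.fract_nonneg y, by simpa using Int.fract_lt_one y⟩]

theorem measurePreserving_add_zsmul (k : ℤ) (hk : k ≠ 0) (y : UnitAddCircle) :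
    MeasurePreserving (fun a : UnitAddCircle => y + k • a) volume volume :=
  (measurePreserving_add_left volume y).comp (Measure.measurePreserving_zsmul volume hk)

/-- Two different points of the orbit of a random point under a random rotation are independent. -/
theorem measurePreserving_add_nsmul_pair {m n : ℕ} (hmn : m ≠ n) :
    MeasurePreserving (fun p : UnitAddCircle × UnitAddCircle => (p.2 + m • p.1, p.2 + n • p.1))
      (volume.prod volume) (volume.prod volume) := by
  -- The map is a composition of two shears and a swap: `(a, x) ↦ (a, x + m a)`, then `(y, a) ↦ (y,
  -- y + (n - m) a)`. The second preserves measure because multiplication by the nonzero integer `n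
  -- - m` preserves Haar measure.
  have h1 : MeasurePreserving
      (fun p : UnitAddCircle × UnitAddCircle => (id p.1, p.2 + m • p.1))
      (volume.prod volume) (volume.prod volume) :=
    (MeasurePreserving.id volume).skew_product
      (g := fun a x : UnitAddCircle => x + m • a) (by fun_prop)
      (ae_of_all _ fun a => (measurePreserving_add_right volume (m • a)).map_eq)
  have h2 : MeasurePreserving
      (fun p : UnitAddCircle × UnitAddCircle => (id p.1, p.1 + ((n : ℤ) - m) • p.2))
      (volume.prod volume) (volume.prod volume) :=
    (MeasurePreserving.id volume).skew_product
      (g := fun y a : UnitAddCircle => y + ((n : ℤ) - m) • a) (by fun_prop)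
      (ae_of_all _ fun y => (measurePreserving_add_zsmul _ (by omega) y).map_eq)
  have h3 := h2.comp (Measure.measurePreserving_swap.comp h1)
  convert h3 using 1
  funext p
  simp only [Function.comp, Prod.swap, id, sub_smul, natCast_zsmul]
  congr 1
  abel

theorem measurePreserving_fract_pair {m n : ℕ} (hmn : m ≠ n) :
    MeasurePreserving
      (fun p : ℝ × ℝ => (Int.fract (p.2 + m * p.1), Int.fract (p.2 + n * p.1)))
      (unif.prod unif) (unif.prod unif) := by
  have h := (measurePreserving_equivIco.prod measurePreserving_equivIco).comp
    ((measurePreserving_add_nsmul_pair hmn).comp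
      (measurePreserving_mk_unif.prod measurePreserving_mk_unif))
  convert h using 1
  funext p
  simp only [Function.comp, Prod.map]
  rw [← equivIco_coe_eq_fract, ← equivIco_coe_eq_fract]
  simp

theorem measurePreserving_fract (n : ℕ) :
    MeasurePreserving (fun p : ℝ × ℝ => Int.fract (p.2 + n * p.1)) (unif.prod unif) unif :=
  measurePreserving_fst.comp (measurePreserving_fract_pair (Nat.succ_ne_self n).symm)

theorem indepFun_fract {m n : ℕ} (hmn : m ≠ n) :
    IndepFun (fun p : ℝ × ℝ => Int.fract (p.2 + m * p.1))
      (fun p : ℝ × ℝ => Int.fract (p.2 + n * p.1)) (unif.prod unif) := by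
  rw [indepFun_iff_map_prod_eq_prod_map_map (measurePreserving_fract m).measurable.aemeasurable
    (measurePreserving_fract n).measurable.aemeasurable, (measurePreserving_fract m).map_eq,
    (measurePreserving_fract n).map_eq, (measurePreserving_fract_pair hmn).map_eq]

theorem memLp_truncRecip_fract {δ : ℝ} (hδ : 0 < δ) (n : ℕ) :
    MemLp (fun p : ℝ × ℝ => truncRecip δ (Int.fract (p.2 + n * p.1))) 2 (unif.prod unif) := by
  refine MemLp.of_bound ((continuous_truncRecip hδ).measurable.comp
    (measurePreserving_fract n).measurable).aestronglyMeasurable (1 / δ) (ae_of_all _ fun p => ?_)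
  rw [Real.norm_of_nonneg (truncRecip_nonneg hδ _)]
  exact truncRecip_le hδ _

theorem integral_comp_fract {g : ℝ → ℝ} (hg : Continuous g) (n : ℕ) :
    ∫ p, g (Int.fract (p.2 + n * p.1)) ∂(unif.prod unif) = ∫ y in (0 : ℝ)..1, g y := by
  have h := integral_map (measurePreserving_fract n).measurable.aemeasurable
    (hg.aestronglyMeasurable (μ := (unif.prod unif).map _))
  rw [(measurePreserving_fract n).map_eq] at h
  rw [← integral_unif, h]

/-- Chebyshev: pairwise independence makes variances add, and each is at most the second moment `2 /
δ`. -/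
theorem measure_le_abs_sum_truncRecip_sub_le {δ : ℝ} (hδ : 0 < δ) (hδ1 : δ ≤ 1) (N : ℕ) {c : ℝ}
    (hc : 0 < c) :
    (unif.prod unif) {p : ℝ × ℝ | c ≤ |∑ n ∈ Finset.range N,
      truncRecip δ (Int.fract (p.2 + n * p.1)) - N * (1 + Real.log (1 / δ))|} ≤
      ENNReal.ofReal (2 * N / (δ * c ^ 2)) := by
  set Y : ℕ → ℝ × ℝ → ℝ := fun n p => truncRecip δ (Int.fract (p.2 + n * p.1)) with hY
  have hL : ∀ n, MemLp (Y n) 2 (unif.prod unif) := memLp_truncRecip_fract hδ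
  have hmean : (unif.prod unif)[∑ n ∈ Finset.range N, Y n] = N * (1 + Real.log (1 / δ)) := by
    simp only [Finset.sum_apply]
    rw [integral_finsetSum _ fun n _ => (hL n).integrable one_le_two]
    simp only [hY, integral_comp_fract (continuous_truncRecip hδ), integral_truncRecip hδ hδ1]
    rw [Finset.sum_const, Finset.card_range, nsmul_eq_mul]
  have hvar : variance (∑ n ∈ Finset.range N, Y n) (unif.prod unif) ≤ N * (2 / δ) := by
    rw [IndepFun.variance_sum (fun n _ => hL n)]
    · calc _ ≤ ∑ n ∈ Finset.range N, 2 / δ := by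
            refine Finset.sum_le_sum fun n _ => (variance_le_expectation_sq (hL n).1).trans ?_
            refine le_trans (le_of_eq ?_) (integral_truncRecip_sq_le hδ hδ1)
            exact integral_comp_fract (g := fun y => truncRecip δ y ^ 2)
              ((continuous_truncRecip hδ).pow 2) n
        _ = _ := by simp
    · intro m _ n _ hmn
      exact (indepFun_fract hmn).comp (continuous_truncRecip hδ).measurable
        (continuous_truncRecip hδ).measurable
  have h := meas_ge_le_variance_div_sq (memLp_finsetSum' (Finset.range N) fun n _ => hL n) hc
  rw [hmean] at h
  simp only [Finset.sum_apply] at h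
  refine h.trans (ENNReal.ofReal_le_ofReal ?_)
  calc _ ≤ N * (2 / δ) / c ^ 2 := by gcongr
    _ = _ := by field_simp

/-- A union bound over at most `N ^ 2` pairs of times, each of probability at most `δ ^ 2` by
independence. -/
theorem measure_two_fract_lt_le {δ : ℝ} (hδ : 0 ≤ δ) (N : ℕ) :
    (unif.prod unif) {p : ℝ × ℝ | ∃ m < N, ∃ n < N, m ≠ n ∧ Int.fract (p.2 + m * p.1) < δ ∧
      Int.fract (p.2 + n * p.1) < δ} ≤ ENNReal.ofReal ((N * δ) ^ 2) := by
  have hunif : unif (Iio δ) ≤ ENNReal.ofReal δ := by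
    rw [unif, Measure.restrict_apply measurableSet_Iio]
    refine (measure_mono (t := Ioo 0 δ) fun y hy => ⟨hy.2.1, hy.1⟩).trans ?_
    rw [Real.volume_Ioo, sub_zero]
  have hpair : ∀ m n : ℕ, m ≠ n → (unif.prod unif) {p : ℝ × ℝ | Int.fract (p.2 + m * p.1) < δ ∧
      Int.fract (p.2 + n * p.1) < δ} ≤ ENNReal.ofReal (δ ^ 2) := fun m n hmn => by
    have h := (measurePreserving_fract_pair hmn).measure_preimage
      (s := Iio δ ×ˢ Iio δ) (measurableSet_Iio.prod measurableSet_Iio).nullMeasurableSet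
    rw [Measure.prod_prod] at h
    refine (le_of_eq h).trans ?_
    rw [sq, ENNReal.ofReal_mul hδ]
    gcongr
  calc _ ≤ (unif.prod unif) (⋃ q ∈ (Finset.range N ×ˢ Finset.range N).filter fun q => q.1 ≠ q.2,
        {p : ℝ × ℝ | Int.fract (p.2 + q.1 * p.1) < δ ∧ Int.fract (p.2 + q.2 * p.1) < δ}) := by
        refine measure_mono fun p hp => ?_
        obtain ⟨m, hm, n, hn, hmn, h1, h2⟩ := hp
        simp only [Set.mem_iUnion]
        exact ⟨(m, n), by simp [hm, hn, hmn], h1, h2⟩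
    _ ≤ ∑ q ∈ (Finset.range N ×ˢ Finset.range N).filter fun q => q.1 ≠ q.2,
        ENNReal.ofReal (δ ^ 2) := by
        refine (measure_biUnion_finset_le _ _).trans (Finset.sum_le_sum fun q hq => ?_)
        exact hpair _ _ (Finset.mem_filter.1 hq).2
    _ ≤ ∑ q ∈ Finset.range N ×ˢ Finset.range N, ENNReal.ofReal (δ ^ 2) :=
        Finset.sum_le_sum_of_subset (Finset.filter_subset _ _)
    _ = ENNReal.ofReal ((N * δ) ^ 2) := by
        rw [Finset.sum_const, Finset.card_product, Finset.card_range, nsmul_eq_mul, mul_pow,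
          ENNReal.ofReal_mul (by positivity), sq (N : ℝ), ENNReal.ofReal_mul (by positivity)]
        simp

end RandomRotation

/-! ### Borel-Cantelli along control times, and interpolation. -/

section AlmostSureLaw

/-- Convergence of `u / g` along a subsequence along which `g` grows slowly gives convergence, for
monotone `u` and `g`. -/
theorem tendsto_div_of_monotone_of_subseq {u g : ℕ → ℝ} (hu : Monotone u) (hg : Monotone g)
    (hu0 : ∀ n, 0 ≤ u n) {N : ℕ → ℕ} (hN : Tendsto N atTop atTop) (hNm : Monotone N) {G : ℕ → ℝ}
    (hG : ∀ᶠ k in atTop, 0 < G k) (huG : Tendsto (fun k => u (N k) / G k) atTop (𝓝 1))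
    (hgG : Tendsto (fun k => g (N k) / G k) atTop (𝓝 1))
    (hGG : Tendsto (fun k => G (k + 1) / G k) atTop (𝓝 1)) :
    Tendsto (fun n => u n / g n) atTop (𝓝 1) := by
  have hG1 : ∀ᶠ k in atTop, 0 < G (k + 1) := (tendsto_add_atTop_nat 1).eventually hG
  have hup : Tendsto (fun k => u (N (k + 1)) / g (N k)) atTop (𝓝 1) := by
    have h := ((huG.comp (tendsto_add_atTop_nat 1)).mul hGG).div hgG one_ne_zero
    rw [one_mul, div_one] at h
    refine h.congr' ?_
    filter_upwards [hG, hG1] with k h1 h2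
    simp only [Function.comp, Pi.div_apply]
    field_simp
  have hlow : Tendsto (fun k => u (N k) / g (N (k + 1))) atTop (𝓝 1) := by
    have h := huG.div ((hgG.comp (tendsto_add_atTop_nat 1)).mul hGG) (by norm_num)
    rw [one_mul, div_one] at h
    refine h.congr' ?_
    filter_upwards [hG, hG1] with k h1 h2
    simp only [Function.comp, Pi.div_apply]
    field_simp
  have hgpos : ∀ᶠ k in atTop, 0 < g (N k) := by
    filter_upwards [hG, hgG.eventually_const_lt zero_lt_one] with k h1 h2
    exact (div_pos_iff_of_pos_right h1).1 h2
  rw [tendsto_order]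
  -- Every large `n` lies in a block `[N k, N (k + 1))` with `k` large, located by the first `j`
  -- with `n < N j`.
  have key : ∀ p : ℕ → Prop, (∀ᶠ k in atTop, 0 < g (N k) → ∀ n, N k ≤ n → n < N (k + 1) → p n) →
      ∀ᶠ n in atTop, p n := fun p hp => by
    obtain ⟨K, hK⟩ := eventually_atTop.1 (hp.and hgpos)
    filter_upwards [eventually_ge_atTop (N K)] with n hn
    have hex : ∃ j, n < N j := (hN.eventually_gt_atTop n).exists
    have hj := Nat.find_spec hex
    have hjK : K < Nat.find hex := by
      by_contra hle
      exact absurd (hNm (not_lt.1 hle)) (by omega)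
    obtain ⟨k, hk⟩ : ∃ k, Nat.find hex = k + 1 := ⟨Nat.find hex - 1, by omega⟩
    have hkn : N k ≤ n := not_lt.1 (Nat.find_min hex (by omega))
    rw [hk] at hj
    exact (hK k (by omega)).1 (hK k (by omega)).2 n hkn hj
  refine ⟨fun a ha => key _ ?_, fun a ha => key _ ?_⟩
  · filter_upwards [hlow.eventually_const_lt ha] with k hk hgk n h1 h2
    have hgn : 0 < g n := hgk.trans_le (hg h1)
    refine hk.trans_le ?_
    calc _ ≤ u n / g (N (k + 1)) := div_le_div_of_nonneg_right (hu h1) (hgn.le.trans (hg h2.le))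
      _ ≤ u n / g n := div_le_div_of_nonneg_left (hu0 n) hgn (hg h2.le)
  · filter_upwards [hup.eventually_lt_const ha] with k hk hgk n h1 h2
    refine lt_of_le_of_lt ?_ hk
    calc _ ≤ u n / g (N k) := div_le_div_of_nonneg_left (hu0 n) hgk (hg h1)
      _ ≤ _ := div_le_div_of_nonneg_right (hu h2.le) hgk.le

/-- Erasing the only time below `δ`, or time `0` if there is none, leaves terms that truncation does
not change. -/
theorem trimmedSum_le_of_unique {α x : ℝ} (hx : x ∈ Ico (0 : ℝ) 1) {N : ℕ} (hN : 1 ≤ N) {δ : ℝ}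
    (hδ : 0 < δ) (h : ¬ ∃ m < N, ∃ n < N, m ≠ n ∧ Int.fract (x + m * α) < δ ∧
      Int.fract (x + n * α) < δ) :
    trimmedSum (rotation α) recip 1 N x ≤
      ∑ n ∈ Finset.range N, truncRecip δ (Int.fract (x + n * α)) := by
  push Not at h
  obtain ⟨i, hi, hlarge⟩ : ∃ i < N, ∀ n < N, n ≠ i → δ ≤ Int.fract (x + n * α) := by
    by_cases hex : ∃ i < N, Int.fract (x + i * α) < δ
    · obtain ⟨i, hi, hlt⟩ := hex
      exact ⟨i, hi, fun n hn hne => h i hi n hn hne.symm hlt⟩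
    · push Not at hex
      exact ⟨0, hN, fun n hn _ => hex n hn⟩
  have h1 := trimmedSum_one_le (rotation α) recip hi x
  simp only [rotation_iterate α hx] at h1
  refine h1.trans ((Finset.sum_le_sum fun n hn => ?_).trans
    (Finset.sum_le_sum_of_subset_of_nonneg (Finset.erase_subset _ _)
      fun _ _ _ => truncRecip_nonneg hδ _))
  rw [Finset.mem_erase, Finset.mem_range] at hn
  rw [truncRecip_of_le (hlarge n hn.2 hn.1)]
  exact recip_le_one_div (Int.fract_nonneg _)

/-- The times at which the trimmed sums are controlled directly. -/
noncomputable def controlTime (k : ℕ) : ℕ := ⌈Real.exp (((k : ℝ) + 1) ^ (9 / 10 : ℝ))⌉₊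

/-- The truncation threshold at the time `controlTime k`. -/
noncomputable def threshold (k : ℕ) : ℝ := 1 / (controlTime k * ((k : ℝ) + 1) ^ (3 / 5 : ℝ))

theorem exp_le_controlTime (k : ℕ) :
    Real.exp (((k : ℝ) + 1) ^ (9 / 10 : ℝ)) ≤ controlTime k := Nat.le_ceil _

theorem one_le_controlTime (k : ℕ) : 1 ≤ controlTime k :=
  Nat.ceil_pos.2 (Real.exp_pos _)

theorem one_le_controlTime_real (k : ℕ) : (1 : ℝ) ≤ controlTime k := by
  exact_mod_cast one_le_controlTime k

theorem controlTime_monotone : Monotone controlTime := fun _ _ h => by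
  unfold controlTime
  gcongr

theorem tendsto_add_one_rpow {s : ℝ} (hs : 0 < s) :
    Tendsto (fun k : ℕ => ((k : ℝ) + 1) ^ s) atTop atTop :=
  (tendsto_rpow_atTop hs).comp
    (tendsto_atTop_add_const_right _ _ tendsto_natCast_atTop_atTop)

theorem tendsto_controlTime_div_exp :
    Tendsto (fun k : ℕ => (controlTime k : ℝ) / Real.exp (((k : ℝ) + 1) ^ (9 / 10 : ℝ)))
      atTop (𝓝 1) :=
  (tendsto_nat_ceil_div_atTop (R := ℝ)).comp
    (Real.tendsto_exp_atTop.comp (tendsto_add_one_rpow (by norm_num)))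

theorem tendsto_controlTime : Tendsto controlTime atTop atTop :=
  tendsto_nat_ceil_atTop.comp
    (Real.tendsto_exp_atTop.comp (tendsto_add_one_rpow (by norm_num)))

theorem rpow_le_log_controlTime (k : ℕ) :
    ((k : ℝ) + 1) ^ (9 / 10 : ℝ) ≤ Real.log (controlTime k) := by
  rw [Real.le_log_iff_exp_le (zero_lt_one.trans_le (one_le_controlTime_real k))]
  exact exp_le_controlTime k

theorem log_controlTime_le (k : ℕ) :
    Real.log (controlTime k) ≤ ((k : ℝ) + 1) ^ (9 / 10 : ℝ) + 1 := by
  set s := ((k : ℝ) + 1) ^ (9 / 10 : ℝ)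
  have hs : 0 ≤ s := by positivity
  rw [Real.log_le_iff_le_exp (zero_lt_one.trans_le (one_le_controlTime_real k)), Real.exp_add]
  have h1 : (controlTime k : ℝ) < Real.exp s + 1 := Nat.ceil_lt_add_one (Real.exp_pos _).le
  have h2 : 1 ≤ Real.exp s := Real.one_le_exp hs
  have h3 : (1 : ℝ) + 1 ≤ Real.exp 1 := Real.add_one_le_exp 1
  nlinarith

theorem tendsto_rpow_div_rpow {s t : ℝ} (hst : s < t) :
    Tendsto (fun k : ℕ => ((k : ℝ) + 1) ^ s / ((k : ℝ) + 1) ^ t) atTop (𝓝 0) := by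
  have h := (tendsto_add_one_rpow (sub_pos.2 hst)).inv_tendsto_atTop
  refine h.congr fun k => ?_
  rw [Pi.inv_apply, ← Real.rpow_neg (by positivity), ← Real.rpow_sub (by positivity), neg_sub]

theorem tendsto_log_controlTime_div :
    Tendsto (fun k : ℕ => Real.log (controlTime k) / ((k : ℝ) + 1) ^ (9 / 10 : ℝ))
      atTop (𝓝 1) := by
  have h0 := tendsto_rpow_div_rpow (s := 0) (t := 9 / 10) (by norm_num)
  have h1 := h0.const_add 1
  rw [add_zero] at h1
  refine tendsto_of_tendsto_of_tendsto_of_le_of_le tendsto_const_nhds h1 (fun k => ?_) fun k => ?_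
  · simp only
    rw [one_le_div (by positivity)]
    exact rpow_le_log_controlTime k
  · simp only [Real.rpow_zero]
    rw [div_le_iff₀ (by positivity), add_mul, one_mul, div_mul_cancel₀ _ (by positivity)]
    exact log_controlTime_le k

/-- The exponent is below `1`, so by Bernoulli's inequality its increments are at most `(k + 1) ^
(-1/10)` and tend to `0`, even inside the exponential. -/
theorem tendsto_ratio :
    Tendsto (fun k : ℕ =>
      Real.exp ((((k + 1 : ℕ) : ℝ) + 1) ^ (9 / 10 : ℝ)) * (((k + 1 : ℕ) : ℝ) + 1) ^ (9 / 10 : ℝ) /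
      (Real.exp (((k : ℝ) + 1) ^ (9 / 10 : ℝ)) * ((k : ℝ) + 1) ^ (9 / 10 : ℝ))) atTop (𝓝 1) := by
  have hbern : ∀ k : ℕ, (((k + 1 : ℕ) : ℝ) + 1) ^ (9 / 10 : ℝ) ≤
      ((k : ℝ) + 1) ^ (9 / 10 : ℝ) + ((k : ℝ) + 1) ^ (-(1 / 10) : ℝ) := fun k => by
    have ht : (0 : ℝ) < (k : ℝ) + 1 := by positivity
    have h1 := rpow_one_add_le_one_add_mul_self (s := 1 / ((k : ℝ) + 1)) (p := 9 / 10)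
      (by have : 0 < 1 / ((k : ℝ) + 1) := by positivity
          linarith) (by norm_num) (by norm_num)
    have h2 : ((k + 1 : ℕ) : ℝ) + 1 = ((k : ℝ) + 1) * (1 + 1 / ((k : ℝ) + 1)) := by
      push_cast
      field_simp
    have h3 : ((k : ℝ) + 1) ^ (-(1 / 10) : ℝ) =
        ((k : ℝ) + 1) ^ (9 / 10 : ℝ) * (1 / ((k : ℝ) + 1)) := by
      rw [show 1 / ((k : ℝ) + 1) = ((k : ℝ) + 1) ^ (-1 : ℝ) by rw [Real.rpow_neg_one, one_div],
        ← Real.rpow_add ht]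
      norm_num
    rw [h2, Real.mul_rpow ht.le (by positivity), h3, ← mul_one_add]
    gcongr
    refine h1.trans ?_
    have : 0 < 1 / ((k : ℝ) + 1) := by positivity
    linarith
  have hmono : ∀ k : ℕ, ((k : ℝ) + 1) ^ (9 / 10 : ℝ) ≤
      (((k + 1 : ℕ) : ℝ) + 1) ^ (9 / 10 : ℝ) := fun k => by
    gcongr
    simp
  have hneg : Tendsto (fun k : ℕ => ((k : ℝ) + 1) ^ (-(1 / 10) : ℝ)) atTop (𝓝 0) := by
    have := tendsto_rpow_div_rpow (s := 0) (t := 1 / 10) (by norm_num)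
    refine this.congr fun k => ?_
    rw [← Real.rpow_sub (by positivity), zero_sub]
  have hexp : Tendsto (fun k : ℕ => Real.exp ((((k + 1 : ℕ) : ℝ) + 1) ^ (9 / 10 : ℝ)) /
      Real.exp (((k : ℝ) + 1) ^ (9 / 10 : ℝ))) atTop (𝓝 1) := by
    have h := (Real.continuous_exp.tendsto 0).comp hneg
    rw [Real.exp_zero] at h
    refine tendsto_of_tendsto_of_tendsto_of_le_of_le tendsto_const_nhds h (fun k => ?_) fun k => ?_
    · simp only
      rw [one_le_div (Real.exp_pos _)]
      exact Real.exp_le_exp.2 (hmono k)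
    · simp only [Function.comp]
      rw [← Real.exp_sub]
      exact Real.exp_le_exp.2 (by linarith [hbern k])
  have hpow : Tendsto (fun k : ℕ => (((k + 1 : ℕ) : ℝ) + 1) ^ (9 / 10 : ℝ) /
      ((k : ℝ) + 1) ^ (9 / 10 : ℝ)) atTop (𝓝 1) := by
    have h := hneg.const_add 1
    rw [add_zero] at h
    refine tendsto_of_tendsto_of_tendsto_of_le_of_le tendsto_const_nhds h (fun k => ?_) fun k => ?_
    · simp only
      rw [one_le_div (by positivity)]
      exact hmono k
    · simp only
      rw [div_le_iff₀ (by positivity)]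
      have h1 : 1 ≤ ((k : ℝ) + 1) ^ (9 / 10 : ℝ) :=
        Real.one_le_rpow (by linarith [(Nat.cast_nonneg k : (0 : ℝ) ≤ k)]) (by norm_num)
      have h2 : 0 ≤ ((k : ℝ) + 1) ^ (-(1 / 10) : ℝ) := by positivity
      nlinarith [hbern k]
  have h := hexp.mul hpow
  rw [one_mul] at h
  refine h.congr fun k => ?_
  rw [div_mul_div_comm]

/-- The set of pairs `(α, x)` for which the trimmed sum at `controlTime k` is not controlled. -/
def exceptionalSet (k : ℕ) : Set (ℝ × ℝ) :=
  {p | (controlTime k : ℝ) * ((k : ℝ) + 1) ^ (17 / 20 : ℝ) ≤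
    |∑ n ∈ Finset.range (controlTime k), truncRecip (threshold k) (Int.fract (p.2 + n * p.1)) -
      controlTime k * (1 + Real.log (1 / threshold k))|} ∪
  {p | ∃ m < controlTime k, ∃ n < controlTime k, m ≠ n ∧
    Int.fract (p.2 + m * p.1) < threshold k ∧ Int.fract (p.2 + n * p.1) < threshold k}

theorem threshold_pos (k : ℕ) : 0 < threshold k := by
  have := one_le_controlTime_real k
  unfold threshold
  positivity

theorem one_le_add_one_rpow (k : ℕ) {s : ℝ} (hs : 0 ≤ s) : 1 ≤ ((k : ℝ) + 1) ^ s :=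
  Real.one_le_rpow (by linarith [(Nat.cast_nonneg k : (0 : ℝ) ≤ k)]) hs

theorem threshold_le_one (k : ℕ) : threshold k ≤ 1 := by
  have h1 := one_le_controlTime_real k
  have h2 := one_le_add_one_rpow k (s := 3 / 5) (by norm_num)
  rw [threshold, div_le_one (by positivity)]
  nlinarith

/-- The exponents are balanced here. Chebyshev gives `2 (k + 1) ^ (3/5 - 17/10)` and double visits
give `(k + 1) ^ (-6/5)`, both summable. The allowed deviation exponent `17/20` still lies below the
`9/10` of `log N`. -/
theorem measure_exceptionalSet_le (k : ℕ) :
    (unif.prod unif) (exceptionalSet k) ≤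
      ENNReal.ofReal (3 * ((k : ℝ) + 1) ^ (-(11 / 10) : ℝ)) := by
  have hN := one_le_controlTime_real k
  have ht : (0 : ℝ) < (k : ℝ) + 1 := by positivity
  have h1 := measure_le_abs_sum_truncRecip_sub_le (threshold_pos k) (threshold_le_one k)
    (controlTime k) (c := controlTime k * ((k : ℝ) + 1) ^ (17 / 20 : ℝ)) (by positivity)
  have h2 := measure_two_fract_lt_le (threshold_pos k).le (controlTime k)
  refine (measure_union_le _ _).trans ((add_le_add h1 h2).trans ?_)
  have hδ := threshold_pos k
  rw [← ENNReal.ofReal_add (by positivity) (by positivity)]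
  apply ENNReal.ofReal_le_ofReal
  have e1 : 2 * (controlTime k : ℝ) / (threshold k *
      (controlTime k * ((k : ℝ) + 1) ^ (17 / 20 : ℝ)) ^ 2) =
      2 * ((k : ℝ) + 1) ^ (-(11 / 10) : ℝ) := by
    have h3 : ((k : ℝ) + 1) ^ (-(11 / 10) : ℝ) =
        ((k : ℝ) + 1) ^ (3 / 5 : ℝ) / (((k : ℝ) + 1) ^ (17 / 20 : ℝ)) ^ 2 := by
      rw [← Real.rpow_natCast, ← Real.rpow_mul ht.le, ← Real.rpow_sub ht]
      norm_num
    rw [h3, threshold]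
    field_simp
  have e2 : (controlTime k * threshold k) ^ 2 ≤ ((k : ℝ) + 1) ^ (-(11 / 10) : ℝ) := by
    have h3 : controlTime k * threshold k = ((k : ℝ) + 1) ^ (-(3 / 5) : ℝ) := by
      rw [Real.rpow_neg ht.le, threshold]
      field_simp
    rw [h3, ← Real.rpow_natCast, ← Real.rpow_mul ht.le]
    apply Real.rpow_le_rpow_of_exponent_le
    · linarith [(Nat.cast_nonneg k : (0 : ℝ) ≤ k)]
    · norm_num
  linarith

theorem ae_eventually_notMem_exceptionalSet :
    ∀ᵐ p ∂(unif.prod unif), ∀ᶠ k in atTop, p ∉ exceptionalSet k := by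
  apply ae_eventually_notMem
  have hs : Summable fun k : ℕ => 3 * ((k : ℝ) + 1) ^ (-(11 / 10) : ℝ) := by
    have h := (summable_nat_add_iff 1).2
      (Real.summable_nat_rpow (p := -(11 / 10)).2 (by norm_num))
    refine (h.mul_left 3).congr fun k => ?_
    push_cast
    rfl
  refine ne_top_of_le_ne_top ?_ (ENNReal.tsum_le_tsum measure_exceptionalSet_le)
  exact hs.tsum_ofReal_ne_top

theorem abs_trimmedSum_sub_le_of_notMem {α x : ℝ} (hx : x ∈ Ico (0 : ℝ) 1) {k : ℕ}
    (h : (α, x) ∉ exceptionalSet k) :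
    |trimmedSum (rotation α) recip 1 (controlTime k) x -
      controlTime k * ((k : ℝ) + 1) ^ (9 / 10 : ℝ)| ≤
      controlTime k * (6 * ((k : ℝ) + 1) ^ (17 / 20 : ℝ)) := by
  rw [exceptionalSet, Set.mem_union, not_or] at h
  obtain ⟨h1, h2⟩ := h
  simp only [Set.mem_ofPred_eq, not_le] at h1
  have hδ := threshold_pos k
  have hN := one_le_controlTime_real k
  have ht : (0 : ℝ) < (k : ℝ) + 1 := by positivity
  have hup := trimmedSum_le_of_unique hx (one_le_controlTime k) hδ h2
  have hlow := sum_truncRecip_sub_le_trimmedSum (α := α) hx (one_le_controlTime k) hδ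
  have hcard : ((Finset.range (controlTime k)).filter fun n : ℕ =>
      Int.fract (x + n * α) < threshold k).card ≤ 1 := by
    rw [Finset.card_le_one]
    intro m hm n hn
    by_contra hmn
    rw [Finset.mem_filter, Finset.mem_range] at hm hn
    exact h2 ⟨m, hm.1, n, hn.1, hmn, hm.2, hn.2⟩
  have hinv : 1 / threshold k = controlTime k * ((k : ℝ) + 1) ^ (3 / 5 : ℝ) := by
    rw [threshold, one_div_one_div]
  have hcard' : ((((Finset.range (controlTime k)).filter fun n : ℕ =>
      Int.fract (x + n * α) < threshold k).card : ℝ) + 1) / threshold k ≤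
      controlTime k * (2 * ((k : ℝ) + 1) ^ (3 / 5 : ℝ)) := by
    calc _ ≤ ((1 : ℝ) + 1) / threshold k := by
          gcongr
          exact_mod_cast hcard
      _ = 2 * (1 / threshold k) := by ring
      _ = _ := by rw [hinv]; ring
  have hlog : Real.log (1 / threshold k) =
      Real.log (controlTime k) + 3 / 5 * Real.log ((k : ℝ) + 1) := by
    rw [hinv, Real.log_mul (by positivity) (by positivity), Real.log_rpow ht]
  have hlog2 : 3 / 5 * Real.log ((k : ℝ) + 1) ≤ ((k : ℝ) + 1) ^ (3 / 5 : ℝ) := by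
    have := Real.log_le_rpow_div ht.le (ε := 3 / 5) (by norm_num)
    rw [le_div_iff₀ (by norm_num)] at this
    linarith
  have hlog3 : 0 ≤ Real.log ((k : ℝ) + 1) :=
    Real.log_nonneg (by linarith [(Nat.cast_nonneg k : (0 : ℝ) ≤ k)])
  have h35 : ((k : ℝ) + 1) ^ (3 / 5 : ℝ) ≤ ((k : ℝ) + 1) ^ (17 / 20 : ℝ) :=
    Real.rpow_le_rpow_of_exponent_le (by linarith [(Nat.cast_nonneg k : (0 : ℝ) ≤ k)])
      (by norm_num)
  have h0 := one_le_add_one_rpow k (s := 17 / 20) (by norm_num)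
  have hl := log_controlTime_le k
  have hg := rpow_le_log_controlTime k
  rw [hlog] at h1
  obtain ⟨h3, h4⟩ := abs_lt.1 h1
  set A := ((k : ℝ) + 1) ^ (9 / 10 : ℝ)
  set B := ((k : ℝ) + 1) ^ (17 / 20 : ℝ)
  set C := ((k : ℝ) + 1) ^ (3 / 5 : ℝ)
  set n := (controlTime k : ℝ)
  set l := Real.log n
  set l' := Real.log ((k : ℝ) + 1)
  have hn0 : 0 ≤ n := by linarith
  -- The constants, `C`, and the `log (k + 1)` term coming from the threshold are all absorbed into
  -- multiples of `B`; the factor `6` is generous.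
  have b1 : n * (1 + (l + 3 / 5 * l')) + n * B ≤ n * A + n * (6 * B) := by
    rw [← mul_add, ← mul_add]
    exact mul_le_mul_of_nonneg_left (by linarith) hn0
  have b2 : n * A - n * (6 * B) ≤ n * (1 + (l + 3 / 5 * l')) - n * B - n * (2 * C) := by
    rw [← mul_sub, ← mul_sub, ← mul_sub]
    exact mul_le_mul_of_nonneg_left (by linarith) hn0
  rw [abs_le]
  constructor <;> linarith

theorem tendsto_trimmedSum_of_eventually_notMem {α x : ℝ} (hx : x ∈ Ico (0 : ℝ) 1)
    (h : ∀ᶠ k in atTop, (α, x) ∉ exceptionalSet k) :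
    Tendsto (fun N : ℕ => trimmedSum (rotation α) recip 1 N x / ((N : ℝ) * Real.log N))
      atTop (𝓝 1) := by
  have hnn : ∀ n, 0 ≤ recip ((rotation α)^[n] x) := fun n => by
    rw [rotation_iterate α hx]
    exact recip_nonneg (Int.fract_nonneg _)
  have hmono := trimmedSum_one_monotone (rotation α) hnn
  have hlogmono : Monotone fun N : ℕ => (N : ℝ) * Real.log N := fun m n hmn => by
    rcases Nat.eq_zero_or_pos m with rfl | hm
    · simpa using mul_nonneg (Nat.cast_nonneg n) (Real.log_natCast_nonneg n)
    · have : (0 : ℝ) < m := by exact_mod_cast hm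
      have := Real.log_natCast_nonneg m
      simp only
      gcongr
  -- The comparison sequence `G` is `N log N` with the ceiling in `controlTime` dropped, which makes
  -- consecutive ratios explicit.
  refine tendsto_div_of_monotone_of_subseq hmono hlogmono (fun n => ?_) tendsto_controlTime
    controlTime_monotone (G := fun k => Real.exp (((k : ℝ) + 1) ^ (9 / 10 : ℝ)) *
      ((k : ℝ) + 1) ^ (9 / 10 : ℝ)) (Eventually.of_forall fun k => by positivity) ?_ ?_ tendsto_ratio
  -- Nonnegativity follows from monotonicity and the default value `0` at `N = 0`.
  · have := hmono (Nat.zero_le n)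
    simpa [trimmedSum] using this
  · have h1 : Tendsto (fun k : ℕ => trimmedSum (rotation α) recip 1 (controlTime k) x /
        (controlTime k * ((k : ℝ) + 1) ^ (9 / 10 : ℝ))) atTop (𝓝 1) := by
      rw [tendsto_iff_norm_sub_tendsto_zero]
      have h2 := (tendsto_rpow_div_rpow (s := 17 / 20) (t := 9 / 10) (by norm_num)).const_mul 6
      rw [mul_zero] at h2
      refine squeeze_zero' (Eventually.of_forall fun _ => norm_nonneg _) ?_ h2
      filter_upwards [h] with k hk
      have hN := one_le_controlTime_real k
      have hpos : 0 < controlTime k * ((k : ℝ) + 1) ^ (9 / 10 : ℝ) := by positivity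
      rw [Real.norm_eq_abs, div_sub_one hpos.ne', abs_div, abs_of_pos hpos]
      calc _ ≤ controlTime k * (6 * ((k : ℝ) + 1) ^ (17 / 20 : ℝ)) /
            (controlTime k * ((k : ℝ) + 1) ^ (9 / 10 : ℝ)) := by
            gcongr
            exact abs_trimmedSum_sub_le_of_notMem hx hk
        _ = _ := by field_simp
    have h2 := h1.mul tendsto_controlTime_div_exp
    rw [one_mul] at h2
    refine h2.congr fun k => ?_
    have hN := one_le_controlTime_real k
    field_simp
  · have h2 := tendsto_controlTime_div_exp.mul tendsto_log_controlTime_div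
    rw [one_mul] at h2
    refine h2.congr fun k => ?_
    rw [div_mul_div_comm]

/-- The lightly trimmed law for almost every rotation number and almost every starting point. -/
theorem ae_ae_tendsto_trimmedSum :
    ∀ᵐ α ∂unif, ∀ᵐ x ∂unif,
      Tendsto (fun N : ℕ => trimmedSum (rotation α) recip 1 N x / ((N : ℝ) * Real.log N))
        atTop (𝓝 1) := by
  filter_upwards [Measure.ae_ae_of_ae_prod ae_eventually_notMem_exceptionalSet] with α hα
  filter_upwards [hα, ae_unif_mem_Ico] with x hx hx01
  exact tendsto_trimmedSum_of_eventually_notMem hx01 hx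

end AlmostSureLaw

end LightTrimming

/-- The lightly trimmed strong law for `1 / x` over irrational rotations. -/
theorem mainTheorem4 :
    (∀ᵐ α : ℝ ∂(volume.restrict (Ioo (0 : ℝ) 1)),
      ∀ᵐ x : ℝ ∂(volume.restrict (Ico (0 : ℝ) 1)),
        Tendsto
          (fun N : ℕ =>
            LightTrimming.trimmedSum (LightTrimming.rotation α) LightTrimming.recip 1 N x /
              ((N : ℝ) * Real.log N))
          atTop (𝓝 1)) ∧
    (∀ α : ℝ, α ∈ Ioo (0 : ℝ) 1 → LightTrimming.BoundedType α →
      TendstoUniformlyOn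
        (fun (N : ℕ) (x : ℝ) =>
          LightTrimming.trimmedSum (LightTrimming.rotation α) LightTrimming.recip 1 N x /
            ((N : ℝ) * Real.log N))
        (fun _ => 1) atTop (Ico (0 : ℝ) 1)) := by

  refine ⟨?_, fun α _ hα => hα.tendstoUniformlyOn_trimmedSum⟩
  -- Endpoints are null, so both restricted measures are `unif`.
  rw [restrict_Ioo_eq_restrict_Ioc, restrict_Ico_eq_restrict_Ioc]
  exact LightTrimming.ae_ae_tendsto_trimmedSum
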